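/- Let $\alpha$ be an indeterminate and let $\Lambda$ be the ring of symmetric functions in infinitely many variables with coefficients in $\mathbb{Q}(\alpha)$, so $\Lambda=\mathbb{Q}(\alpha)[p_1,p_2,\dots]$ with $p_k$ the $k$-th power sum. For a partition $\mu$ with $m_k$ parts equal to $k$ and $\ell(\mu)$ parts in total, put $p_\mu=\prod_i p_{\mu_i}$ and $z_\mu=\prod_k k^{m_k}m_k!$, and let $\langle\,,\rangle$ be the bilinear form on $\Lambda$ with $\langle p_\mu,p_\nu\rangle=\delta_{\mu\nu}\,z_\mu\,\alpha^{\ell(\mu)}$. Let $m_\mu$ be the symmetric monomials and $\le$ the dominance ordering on partitions of the same integer. There is a unique family $(J_\mu)$ of elements of $\Lambda$, indexed by all partitions $\mu$ (the Jack symmetric functions), such that (i) $\langle J_\mu,J_\nu\rangle=0$ if $\mu\neq\nu$; (ii) $J_\nu=\sum_{\mu\le\nu}v_{\nu\mu}(\alpha)\,m_\mu$ with $v_{\nu\mu}(\alpha)\in\mathbb{Q}(\alpha)$; (iii) $v_{\nu,1^N}=N!$ if $|\nu|=N$. Let $J_\mu(x_1,\dots,x_n;\alpha)$ be the symmetric polynomial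 obtained from $J_\mu$ by restriction to $n$ variables. On $\mathbb{Q}(\alpha)[x_1,\dots,x_n]$ consider the Dunkl operators $$D_i=\alpha x_i\frac{\partial}{\partial x_i}+\sum_{j\ne i}\frac{x_i}{x_i-x_j}(1-K_{ij}),\qquad i=1,\dots,n,$$ where $K_{ij}$ exchanges $x_i$ and $x_j$, and the creation operators $$B_i^+=\sum_{J\subset\{1,\dots,n\},\ |J|=i}x_J\,D_J,\qquad x_J=\prod_{j\in J}x_j,\qquad D_J=(D_{j_1}+1)(D_{j_2}+2)\cdots(D_{j_i}+i)\ \text{ for } J=\{j_1<j_2<\dots<j_i\}.$$ Then for every $n\ge 0$ and all integers $\lambda_1\ge\lambda_2\ge\dots\ge\lambda_n\ge 0$, with $\lambda=(\lambda_1,\dots,\lambda_n)$, $$J_\lambda(x_1,\dots,x_n;\alpha)=(B_n^+)^{\lambda_n}(B_{n-1}^+)^{\lambda_{n-1}-\lambda_n}\cdots(B_1^+)^{\lambda_1-\lambda_2}\cdot 1 .$$ -/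

import Mathlib

noncomputable section

namespace JackRodrigues

/-! Symmetric functions in infinitely many variables and their restriction to `n` variables -/

/-- The ring `Λ ⊗ K` of symmetric functions in infinitely many variables (`K` of characteristic
zero), presented as the polynomial ring in the power sums: the variable `X k` is `p_k`, `k ≥ 1`. -/
abbrev SymFun (K : Type*) [Field K] : Type _ := MvPolynomial ℕ+ K

/-- The symmetric polynomial `f(x_1, …, x_n)`, that is, `p_k ↦ x_1 ^ k + ⋯ + x_n ^ k`. -/
def toVars {K : Type*} [Field K] (n : ℕ) : SymFun K →ₐ[K] MvPolynomial (Fin n) K :=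
  MvPolynomial.aeval fun k : ℕ+ => MvPolynomial.psum (Fin n) K (k : ℕ)

/-- `z_μ = ∏_k k ^ m_k * m_k !`, for the partition `μ` with `m k` parts equal to `k`. -/
def zed (m : ℕ+ →₀ ℕ) : ℕ :=
  m.prod fun k mk => (k : ℕ) ^ mk * mk.factorial

/-- The bilinear scalar product with `⟨p_μ, p_ν⟩ = δ_{μν} z_μ α ^ ℓ(μ)`. The coefficient of `f` at
the exponent vector `m` is the coefficient of `p_μ`, where `μ` has `m k` parts equal to `k`; the
number of parts is `ℓ(μ) = m.degree`. -/
def scalarProduct {K : Type*} [Field K] (α : K) (f g : SymFun K) : K :=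
  ∑ m ∈ f.support, f.coeff m * g.coeff m * ((zed m : K) * α ^ m.degree)

/-- `μ ≤ ν` in the dominance ordering of partitions of `N`. -/
def DominatedBy {N : ℕ} (μ ν : N.Partition) : Prop :=
  ∀ i : ℕ, ((μ.parts.sort (· ≥ ·)).take i).sum ≤ ((ν.parts.sort (· ≥ ·)).take i).sum

/-- The partition `1 ^ N`. -/
def onesPartition (N : ℕ) : N.Partition :=
  Nat.Partition.ofSums N (Multiset.replicate N 1) (by simp)

/-- The conditions that specify the Jack functions `J_μ`, `μ` running over all partitions:
orthogonality, triangularity in the symmetric monomials with respect to the dominance ordering, and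
the normalization `v_{μ, 1 ^ N} = N!`. An identity in `Λ` is expressed as the identity of the
symmetric polynomials in `n` variables for all `n`. -/
structure IsJackFamily {K : Type*} [Field K] (α : K)
    (Jack : (N : ℕ) → N.Partition → SymFun K) : Prop where
  orthogonal : ∀ (M N : ℕ) (μ : M.Partition) (ν : N.Partition),
    (⟨M, μ⟩ : (k : ℕ) × k.Partition) ≠ ⟨N, ν⟩ → scalarProduct α (Jack M μ) (Jack N ν) = 0
  triangular : ∀ (N : ℕ) (ν : N.Partition), ∃ v : N.Partition → K,
    (∀ μ, ¬ DominatedBy μ ν → v μ = 0) ∧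
    (∀ n : ℕ, toVars n (Jack N ν) =
      ∑ μ : N.Partition, v μ • MvPolynomial.msymm (Fin n) K μ) ∧
    v (onesPartition N) = (N.factorial : K)

/-! Dunkl operators and creation operators -/

/-- The operator `K_{ij}` exchanging the variables `x_i` and `x_j`. -/
def exchange {K : Type*} [Field K] {n : ℕ} (i j : Fin n) :
    MvPolynomial (Fin n) K →ₐ[K] MvPolynomial (Fin n) K :=
  MvPolynomial.rename (Equiv.swap i j)

theorem sub_dvd_sub_exchange {K : Type*} [Field K] {n : ℕ} (i j : Fin n)
    (f : MvPolynomial (Fin n) K) :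
    (MvPolynomial.X i - MvPolynomial.X j : MvPolynomial (Fin n) K) ∣ f - exchange i j f := by
  rw [← Ideal.mem_span_singleton, ← Ideal.Quotient.mk_eq_mk_iff_sub_mem]
  set I : Ideal (MvPolynomial (Fin n) K) :=
    Ideal.span {(MvPolynomial.X i - MvPolynomial.X j : MvPolynomial (Fin n) K)} with hI
  have hij : Ideal.Quotient.mk I (MvPolynomial.X i) = Ideal.Quotient.mk I (MvPolynomial.X j) := by
    rw [Ideal.Quotient.mk_eq_mk_iff_sub_mem]
    exact Ideal.mem_span_singleton_self _
  have h : Ideal.Quotient.mkₐ K I = (Ideal.Quotient.mkₐ K I).comp (exchange i j) := by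
    apply MvPolynomial.algHom_ext
    intro k
    simp only [AlgHom.comp_apply, exchange, MvPolynomial.rename_X, Ideal.Quotient.mkₐ_eq_mk]
    rcases eq_or_ne k i with rfl | hki
    · rw [Equiv.swap_apply_left]
      exact hij
    · rcases eq_or_ne k j with rfl | hkj
      · rw [Equiv.swap_apply_right]
        exact hij.symm
      · rw [Equiv.swap_apply_of_ne_of_ne hki hkj]
  exact DFunLike.congr_fun h f

theorem X_sub_X_ne_zero {K : Type*} [Field K] {n : ℕ} {i j : Fin n} (h : i ≠ j) :
    (MvPolynomial.X i - MvPolynomial.X j : MvPolynomial (Fin n) K) ≠ 0 :=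
  sub_ne_zero.mpr fun e => h (MvPolynomial.X_injective e)

/-- For `i ≠ j`, the operator `f ↦ (f - K_{ij} f) / (x_i - x_j)`; the quotient is a polynomial. -/
def dividedDifference {K : Type*} [Field K] {n : ℕ} (i j : Fin n) (h : i ≠ j) :
    Module.End K (MvPolynomial (Fin n) K) where
  toFun f := (sub_dvd_sub_exchange i j f).choose
  map_add' f g := by
    apply mul_left_cancel₀ (X_sub_X_ne_zero (K := K) h)
    rw [mul_add, ← (sub_dvd_sub_exchange i j (f + g)).choose_spec,
      ← (sub_dvd_sub_exchange i j f).choose_spec, ← (sub_dvd_sub_exchange i j g).choose_spec,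
      map_add]
    ring
  map_smul' c f := by
    apply mul_left_cancel₀ (X_sub_X_ne_zero (K := K) h)
    rw [RingHom.id_apply, mul_smul_comm, ← (sub_dvd_sub_exchange i j (c • f)).choose_spec,
      ← (sub_dvd_sub_exchange i j f).choose_spec, map_smul, smul_sub]

/-- Multiplication by a polynomial, as an operator. -/
def mulBy {K : Type*} [Field K] {n : ℕ} (f : MvPolynomial (Fin n) K) :
    Module.End K (MvPolynomial (Fin n) K) :=
  LinearMap.mulLeft K f

/-- The Dunkl operator
`D_i = α x_i ∂/∂x_i + ∑_{j ≠ i} x_i / (x_i - x_j) (1 - K_{ij})`. -/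
def dunkl {K : Type*} [Field K] (α : K) {n : ℕ} (i : Fin n) :
    Module.End K (MvPolynomial (Fin n) K) :=
  α • (mulBy (MvPolynomial.X i) * (MvPolynomial.pderiv i).toLinearMap) +
    ∑ j : Fin n, if h : i ≠ j then mulBy (MvPolynomial.X i) * dividedDifference i j h else 0

/-- `D_J = (D_{j_1} + 1) (D_{j_2} + 2) ⋯ (D_{j_ℓ} + ℓ)` for `J = {j_1 < j_2 < ⋯ < j_ℓ}`. -/
def dunklProd {K : Type*} [Field K] (α : K) {n : ℕ} (J : Finset (Fin n)) :
    Module.End K (MvPolynomial (Fin n) K) :=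
  (List.ofFn fun k : Fin J.card =>
    dunkl α (J.orderEmbOfFin rfl k) + (((k : ℕ) + 1 : ℕ) : Module.End K _)).prod

/-- The creation operator `B_i^+ = ∑_{|J| = i} x_J D_J`, where `x_J = ∏_{j ∈ J} x_j`. -/
def creation {K : Type*} [Field K] (α : K) (n i : ℕ) :
    Module.End K (MvPolynomial (Fin n) K) :=
  ∑ J ∈ Finset.powersetCard i (Finset.univ : Finset (Fin n)),
    mulBy (∏ j ∈ J, MvPolynomial.X j) * dunklProd α J

/-- The part `lam_i`, `1 ≤ i ≤ n`, of `lam = (lam_1, …, lam_n)`, and `0` for other `i`. -/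
def part {n : ℕ} (lam : Fin n → ℕ) (i : ℕ) : ℕ :=
  if h : 1 ≤ i ∧ i ≤ n then lam ⟨i - 1, by omega⟩ else 0

/-- `(B_n^+)^{lam_n} (B_{n-1}^+)^{lam_{n-1} - lam_n} ⋯ (B_1^+)^{lam_1 - lam_2} · 1`. -/
def rodrigues {K : Type*} [Field K] (α : K) {n : ℕ} (lam : Fin n → ℕ) :
    MvPolynomial (Fin n) K :=
  (List.ofFn fun k : Fin n =>
    creation α n (n - k) ^ (part lam (n - k) - part lam (n - k + 1))).prod 1

/-- The partition whose nonzero parts are the nonzero entries of `lam = (lam_1, …, lam_n)`. -/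
def toPartition {n : ℕ} (lam : Fin n → ℕ) : (∑ i, lam i).Partition :=
  Nat.Partition.ofSums _ (Finset.univ.val.map lam) rfl

end JackRodrigues

end

/-!
Let `Ω(x; y) = ∑_μ p_μ(x) p_μ(y) / (z_μ α ^ ℓ(μ)) = ∏ (1 - x_a y_k) ^ (-1 / α)` be the reproducing
kernel of the scalar product, in `x_1, …, x_n` and `y_1, …, y_i`, and write `D_a = x_a T_a`. On
`Ω`, and on products of `Ω` with factors `1 / (1 - x_a y_k)`, the operators `T_a` and `D_a + s` can
be computed explicitly. The outcome is that `B_i^+` in the `n` variables `x` and `T_1 ⋯ T_i` in the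
`i` variables `y` turn `Ω` into the same function. By duality the words
`(B_i^+)^{d_i} ⋯ (B_1^+)^{d_1} · 1` are, for every `n`, the restrictions of one symmetric function
`J_λ`, where `λ` has `d_k` columns of length `k`, and `⟨J_λ, g⟩` is computed by powers of the
operators `T_1 ⋯ T_k` applied to `g`.

In the dominance ordering, an application of `B_i^+` adds at most a column of length `i` to an
exponent, which gives the triangularity of `J_λ`, and `T_1 ⋯ T_i` removes at least such a column, so
that `⟨J_λ, J_μ⟩ ≠ 0` forces `λ ≤ μ`, and then `λ = μ` by symmetry. An orthogonal triangular family
is determined up to scalars because the form is anisotropic: it becomes positive definite when `α`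
is specialized to a positive number.
-/

noncomputable section

namespace JackRodrigues

open MvPolynomial TensorProduct

/-! ### Dominance of exponents -/

section Dominance

variable {σ τ ρ : Type*}

/-- The dominance preorder on families of naturals: every finite partial sum of values of `a` is
bounded by a partial sum of at most as many values of `b`. For partitions this is the dominance
ordering, and the rows need not be sorted. -/
def Dominated (a : σ → ℕ) (b : τ → ℕ) : Prop :=
  ∀ S : Finset σ, ∃ T : Finset τ, T.card ≤ S.card ∧ ∑ s ∈ S, a s ≤ ∑ t ∈ T, b t

theorem Dominated.trans {a : σ → ℕ} {b : τ → ℕ} {c : ρ → ℕ}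
    (hab : Dominated a b) (hbc : Dominated b c) : Dominated a c := by
  intro S
  obtain ⟨T, hTS, hT⟩ := hab S
  obtain ⟨U, hUT, hU⟩ := hbc T
  exact ⟨U, hUT.trans hTS, hT.trans hU⟩

theorem Dominated.of_le {a b : σ → ℕ} (h : a ≤ b) : Dominated a b :=
  fun S => ⟨S, le_rfl, Finset.sum_le_sum fun s _ => h s⟩

theorem Dominated.refl (a : σ → ℕ) : Dominated a a :=
  .of_le le_rfl

theorem dominated_comp (a : σ → ℕ) {e : τ → σ} (he : e.Injective) : Dominated (a ∘ e) a :=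
  fun S => ⟨S.map ⟨e, he⟩, (S.card_map _).le, by simp⟩

theorem dominated_comp_of_support_subset {a : σ → ℕ} {e : τ → σ} (he : e.Injective)
    (ha : a.support ⊆ Set.range e) : Dominated a (a ∘ e) := by
  refine fun S => ⟨S.preimage e he.injOn, ?_, ?_⟩
  · exact Finset.card_le_card_of_injOn e (fun t ht => by simpa using ht) he.injOn
  · exact (Finset.sum_preimage e S he.injOn a fun s _ hs =>
      Function.notMem_support.1 (mt (@ha s) hs)).ge

theorem Dominated.of_pair_of_le {a b : σ → ℕ} {i j : σ} (hij : i ≠ j) (hb : b j ≤ b i)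
    (h : ∀ k, k ≠ i → k ≠ j → a k = b k) (hsum : a i + a j ≤ b i + b j)
    (hi : a i ≤ b i) (hj : a j ≤ b i) : Dominated a b := by
  classical
  intro S
  by_cases hjS : j ∈ S
  · by_cases hiS : i ∈ S
    · refine ⟨S, le_rfl, ?_⟩
      have hS : {i, j} ⊆ S := Finset.insert_subset hiS (Finset.singleton_subset_iff.2 hjS)
      rw [← Finset.sum_sdiff hS, ← Finset.sum_sdiff hS, Finset.sum_pair hij, Finset.sum_pair hij]
      refine add_le_add (Finset.sum_le_sum fun k hk => (h k ?_ ?_).le) hsum <;> grind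
    · refine ⟨S.map (Equiv.swap i j).toEmbedding, (S.card_map _).le, ?_⟩
      rw [Finset.sum_map]
      refine Finset.sum_le_sum fun k hk => ?_
      rcases eq_or_ne k j with rfl | hkj
      · simpa using hj
      · have hki : k ≠ i := ne_of_mem_of_not_mem hk hiS
        simpa [Equiv.swap_apply_of_ne_of_ne hki hkj] using (h k hki hkj).le
  · refine ⟨S, le_rfl, Finset.sum_le_sum fun k hk => ?_⟩
    rcases eq_or_ne k i with rfl | hki
    · exact hi
    · exact (h k hki (ne_of_mem_of_not_mem hk hjS)).le

theorem Dominated.of_pair {a b : σ → ℕ} {i j : σ} (hij : i ≠ j)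
    (h : ∀ k, k ≠ i → k ≠ j → a k = b k) (hsum : a i + a j ≤ b i + b j)
    (hi : a i ≤ max (b i) (b j)) (hj : a j ≤ max (b i) (b j)) : Dominated a b := by
  rcases le_total (b j) (b i) with hb | hb
  · rw [max_eq_left hb] at hi hj
    exact .of_pair_of_le hij hb h hsum hi hj
  · rw [max_eq_right hb] at hi hj
    exact .of_pair_of_le hij.symm hb (fun k hkj hki => h k hki hkj) (by omega) hj hi

/-- The exponent vector of the squarefree monomial `x_J`. -/
def indicatorExp (J : Finset σ) : σ →₀ ℕ :=
  ∑ j ∈ J, Finsupp.single j 1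

theorem indicatorExp_apply [DecidableEq σ] (J : Finset σ) (k : σ) :
    indicatorExp J k = if k ∈ J then 1 else 0 := by
  simp [indicatorExp, Finsupp.finsetSum_apply, Finsupp.single_apply]

theorem indicatorExp_insert [DecidableEq σ] {J : Finset σ} {a : σ} (ha : a ∉ J) :
    indicatorExp (insert a J) = Finsupp.single a 1 + indicatorExp J :=
  Finset.sum_insert ha

theorem sum_indicatorExp [DecidableEq σ] (S J : Finset σ) :
    ∑ s ∈ S, indicatorExp J s = (S ∩ J).card := by
  simp [indicatorExp_apply, Finset.sum_ite_mem]

theorem Dominated.add_indicatorExp {a : σ → ℕ} {b : τ → ℕ} (h : Dominated a b) {J : Finset σ}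
    {I : Finset τ} (hb : b.support ⊆ I) (hJ : J.card ≤ I.card) :
    Dominated (a + ⇑(indicatorExp J)) (b + ⇑(indicatorExp I)) := by
  classical
  intro S
  obtain ⟨T, hTS, hT⟩ := h S
  have hTI : ∑ t ∈ T ∩ I, b t = ∑ t ∈ T, b t :=
    Finset.sum_subset Finset.inter_subset_left fun t htT ht =>
      Function.notMem_support.1 fun htb => ht (Finset.mem_inter.2 ⟨htT, hb htb⟩)
  obtain ⟨U, hTU, hUI, hU⟩ := Finset.exists_subsuperset_card_eq
    (Finset.inter_subset_right (s₁ := T))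
    (le_min ((Finset.card_le_card Finset.inter_subset_left).trans hTS)
      (Finset.card_le_card Finset.inter_subset_right)) (min_le_right S.card I.card)
  have hSJ : (S ∩ J).card ≤ min S.card I.card :=
    le_min (Finset.card_le_card Finset.inter_subset_left)
      ((Finset.card_le_card Finset.inter_subset_right).trans hJ)
  refine ⟨U, hU.trans_le (min_le_left _ _), ?_⟩
  simp only [Pi.add_apply, Finset.sum_add_distrib, sum_indicatorExp,
    Finset.inter_eq_left.2 hUI, hU]
  exact add_le_add (hT.trans (hTI.symm.trans_le (Finset.sum_le_sum_of_subset hTU))) hSJ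

end Dominance

/-! ### Exponents in the image of a Dunkl operator -/

section MulByLemmas

variable {K : Type*} [Field K] {n : ℕ}

@[simp]
theorem mulBy_apply (f g : MvPolynomial (Fin n) K) : mulBy f g = f * g :=
  LinearMap.mulLeft_apply ..

theorem natCast_end_apply {V : Type*} [AddCommGroup V] [Module K V] (k : ℕ) (v : V) :
    (k : Module.End K V) v = (k : K) • v := by
  rw [Module.End.natCast_apply, Nat.cast_smul_eq_nsmul]

theorem exists_coeff_ne_zero_of_linearMap_ne_zero {σ V : Type*} [AddCommGroup V] [Module K V]
    (L : MvPolynomial σ K →ₗ[K] V) {f : MvPolynomial σ K} (h : L f ≠ 0) :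
    ∃ c, coeff c f ≠ 0 ∧ L (monomial c 1) ≠ 0 := by
  have hL : L f = ∑ c ∈ f.support, coeff c f • L (monomial c 1) := by
    conv_lhs => rw [f.as_sum, map_sum]
    refine Finset.sum_congr rfl fun c _ => ?_
    rw [← map_smul, smul_monomial, smul_eq_mul, mul_one]
  rw [hL] at h
  obtain ⟨c, -, hc⟩ := Finset.exists_ne_zero_of_sum_ne_zero h
  exact ⟨c, left_ne_zero_of_smul hc, right_ne_zero_of_smul hc⟩

theorem exists_coeff_ne_zero_of_coeff_map_ne_zero {σ τ : Type*}
    (L : MvPolynomial σ K →ₗ[K] MvPolynomial τ K) {f : MvPolynomial σ K} {c' : τ →₀ ℕ}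
    (h : coeff c' (L f) ≠ 0) : ∃ c, coeff c f ≠ 0 ∧ coeff c' (L (monomial c 1)) ≠ 0 :=
  exists_coeff_ne_zero_of_linearMap_ne_zero (lcoeff K c' ∘ₗ L) h

end MulByLemmas

section DividedDifference

variable {K : Type*} [Field K] {n : ℕ} {i j : Fin n}

theorem X_sub_X_mul_dividedDifference (h : i ≠ j) (f : MvPolynomial (Fin n) K) :
    (X i - X j) * dividedDifference i j h f = f - exchange i j f :=
  (sub_dvd_sub_exchange i j f).choose_spec.symm

theorem dividedDifference_eq (h : i ≠ j) {f g : MvPolynomial (Fin n) K}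
    (hg : (X i - X j) * g = f - exchange i j f) : dividedDifference i j h f = g :=
  mul_left_cancel₀ (X_sub_X_ne_zero (K := K) h)
    ((X_sub_X_mul_dividedDifference h f).trans hg.symm)

theorem exchange_exchange (f : MvPolynomial (Fin n) K) : exchange i j (exchange i j f) = f := by
  simp [exchange, rename_rename, ← Equiv.coe_trans]

theorem dividedDifference_exchange (h : i ≠ j) (f : MvPolynomial (Fin n) K) :
    dividedDifference i j h (exchange i j f) = -dividedDifference i j h f := by
  apply dividedDifference_eq
  rw [mul_neg, X_sub_X_mul_dividedDifference, exchange_exchange, neg_sub]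

theorem exchange_monomial_of_eq {c : Fin n →₀ ℕ} (hc : c i = c j) (r : K) :
    exchange i j (monomial c r) = monomial c r := by
  rw [exchange, rename_monomial, ← Finsupp.equivMapDomain_eq_mapDomain]
  congr
  ext k
  rw [Finsupp.equivMapDomain_apply, Equiv.symm_swap, Equiv.swap_apply_def]
  split_ifs with hki hkj <;> simp [*]

theorem dividedDifference_monomial_add_single (h : i ≠ j) {c : Fin n →₀ ℕ} (hc : c i = c j)
    (d : ℕ) :
    dividedDifference i j h (monomial (c + Finsupp.single i d) (1 : K)) =
      ∑ s ∈ Finset.range d,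
        monomial (c + (Finsupp.single i s + Finsupp.single j (d - 1 - s))) 1 := by
  have hmul (e : Fin n →₀ ℕ) : monomial (c + e) (1 : K) = monomial c 1 * monomial e 1 := by
    rw [monomial_mul, one_mul]
  have hpow : exchange i j (X i ^ d) = (X j ^ d : MvPolynomial (Fin n) K) := by
    simp [exchange]
  apply dividedDifference_eq
  simp only [hmul, ← X_pow_eq_monomial, map_mul, exchange_monomial_of_eq hc, hpow,
    monomial_single_add, ← Finset.mul_sum]
  linear_combination
    monomial c (1 : K) * (Commute.all (X i : MvPolynomial (Fin n) K) (X j)).mul_geom_sum₂ d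

theorem exists_eq_add_single (h : i ≠ j) (c : Fin n →₀ ℕ) :
    ∃ (e : Fin n →₀ ℕ) (d : ℕ), e i = e j ∧ (c = e + Finsupp.single i d ∨
      c = e + Finsupp.single j d) := by
  rcases le_total (c j) (c i) with hle | hle
  · refine ⟨c - Finsupp.single i (c i - c j), c i - c j, ?_, .inl ?_⟩
    · simp [h, Nat.sub_sub_self hle]
    · exact (tsub_add_cancel_of_le (by simp)).symm
  · refine ⟨c - Finsupp.single j (c j - c i), c j - c i, ?_, .inr ?_⟩
    · simp [h.symm, Nat.sub_sub_self hle]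
    · exact (tsub_add_cancel_of_le (by simp)).symm

theorem exists_of_coeff_dividedDifference_ne_zero (h : i ≠ j) {e c' : Fin n →₀ ℕ} (he : e i = e j)
    {d : ℕ}
    (hc : coeff c' (dividedDifference i j h (monomial (e + Finsupp.single i d) (1 : K))) ≠ 0) :
    ∃ s < d, c' = e + (Finsupp.single i s + Finsupp.single j (d - 1 - s)) := by
  rw [dividedDifference_monomial_add_single h he, coeff_sum] at hc
  obtain ⟨s, hs, hs'⟩ := Finset.exists_ne_zero_of_sum_ne_zero hc
  rw [coeff_monomial] at hs'
  exact ⟨s, Finset.mem_range.1 hs, (of_not_not fun hne => hs' (if_neg hne)).symm⟩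

theorem exponent_of_coeff_dividedDifference_ne_zero (h : i ≠ j) {c c' : Fin n →₀ ℕ}
    (hc : coeff c' (dividedDifference i j h (monomial c (1 : K))) ≠ 0) :
    (∀ k, k ≠ i → k ≠ j → c' k = c k) ∧ c' i + c' j + 1 = c i + c j ∧
      c' i < max (c i) (c j) ∧ c' j < max (c i) (c j) := by
  obtain ⟨e, d, he, hc₀⟩ := exists_eq_add_single h c
  have hc' : coeff c' (dividedDifference i j h
      (monomial (e + Finsupp.single i d) (1 : K))) ≠ 0 := by
    rcases hc₀ with rfl | rfl
    · exact hc
    · have hswap : exchange i j (monomial (e + Finsupp.single i d) (1 : K)) =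
          monomial (e + Finsupp.single j d) 1 := by
        rw [← mul_one (1 : K), ← monomial_mul, ← monomial_mul, map_mul,
          exchange_monomial_of_eq he, ← X_pow_eq_monomial, ← X_pow_eq_monomial]
        simp [exchange]
      rwa [← hswap, dividedDifference_exchange, coeff_neg, neg_ne_zero] at hc
  obtain ⟨s, hs, rfl⟩ := exists_of_coeff_dividedDifference_ne_zero h he hc'
  rcases hc₀ with rfl | rfl <;>
    refine ⟨fun k hki hkj => by simp [hki.symm, hkj.symm], ?_, ?_, ?_⟩ <;>
      simp [h, h.symm, he] <;> omega

end DividedDifference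

section Dunkl

variable {K : Type*} [Field K] {n : ℕ}

/-- The rational Dunkl operator `T_i = α ∂/∂x_i + ∑_{j ≠ i} 1 / (x_i - x_j) (1 - K_{ij})`, so that
`D_i = x_i T_i`. -/
def rationalDunkl (α : K) (i : Fin n) : Module.End K (MvPolynomial (Fin n) K) :=
  α • (pderiv i).toLinearMap + ∑ j : Fin n, if h : i ≠ j then dividedDifference i j h else 0

theorem dunkl_eq_mulBy_mul_rationalDunkl (α : K) (i : Fin n) :
    dunkl α i = mulBy (X i) * rationalDunkl α i := by
  rw [dunkl, rationalDunkl, mul_add, mul_smul_comm, Finset.mul_sum]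
  congr 1
  refine Finset.sum_congr rfl fun j _ => ?_
  split_ifs <;> simp

theorem dominated_of_coeff_dividedDifference_monomial {a b : Fin n} (hab : a ≠ b)
    {J : Finset (Fin n)} (ha : a ∉ J) {c c' : Fin n →₀ ℕ}
    (hc : coeff c' (dividedDifference a b hab (monomial c (1 : K))) ≠ 0) :
    Dominated (c' + indicatorExp (insert a J)) (c + indicatorExp J) := by
  obtain ⟨hrest, hsum, hca, hcb⟩ := exponent_of_coeff_dividedDifference_ne_zero hab hc
  have haJ : indicatorExp J a = 0 := by simp [indicatorExp_apply, ha]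
  have hbJ : indicatorExp J b ≤ 1 := by rw [indicatorExp_apply]; split_ifs <;> simp
  rw [indicatorExp_insert ha]
  refine .of_pair hab (fun k hka hkb => ?_) ?_ ?_ ?_
  · simp [hrest k hka hkb, hka.symm]
  all_goals
    simp only [Finsupp.add_apply, Finsupp.single_eq_same, Finsupp.single_eq_of_ne hab.symm, haJ]
    omega

theorem eq_add_single_of_coeff_pderiv_monomial {σ : Type*} {a : σ} {c c' : σ →₀ ℕ}
    (hc : coeff c' (pderiv a (monomial c (1 : K))) ≠ 0) : c = c' + Finsupp.single a 1 := by
  classical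
  rw [pderiv_monomial, one_mul, coeff_monomial] at hc
  obtain ⟨hc', hca⟩ : c - Finsupp.single a 1 = c' ∧ c a ≠ 0 := by
    split_ifs at hc with h
    · exact ⟨h, fun h0 => hc (by simp [h0])⟩
    · exact absurd rfl hc
  rw [← hc', Finsupp.sub_add_single_one_cancel hca]

/-- `T_a` lowers the degree by one, and the exponent `c'` stays dominated by `c` when the lost box
is put back into a row `a` that has not been used before. -/
theorem dominated_of_coeff_rationalDunkl_monomial (α : K) {a : Fin n} {J : Finset (Fin n)}
    (ha : a ∉ J) {c c' : Fin n →₀ ℕ}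
    (hc : coeff c' (rationalDunkl α a (monomial c (1 : K))) ≠ 0) :
    Dominated (c' + indicatorExp (insert a J)) (c + indicatorExp J) := by
  rw [rationalDunkl, LinearMap.add_apply, coeff_add] at hc
  by_cases hder : coeff c' (pderiv a (monomial c (1 : K))) = 0
  · rw [LinearMap.smul_apply, Derivation.coeFn_coe, coeff_smul, hder, smul_zero, zero_add,
      LinearMap.sum_apply, coeff_sum] at hc
    obtain ⟨b, -, hb⟩ := Finset.exists_ne_zero_of_sum_ne_zero hc
    split_ifs at hb with hab
    · exact dominated_of_coeff_dividedDifference_monomial hab ha hb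
    · exact absurd (coeff_zero c') hb
  · rw [eq_add_single_of_coeff_pderiv_monomial hder, indicatorExp_insert ha, add_assoc]
    exact .refl _

theorem dominated_of_coeff_dunkl (α : K) (a : Fin n) {f : MvPolynomial (Fin n) K}
    {c' : Fin n →₀ ℕ} (hc : coeff c' (dunkl α a f) ≠ 0) :
    ∃ c, coeff c f ≠ 0 ∧ Dominated c' c := by
  rw [dunkl_eq_mulBy_mul_rationalDunkl, Module.End.mul_apply, mulBy_apply, coeff_X_mul'] at hc
  split_ifs at hc with ha
  · obtain ⟨c, hcf, hc'⟩ := exists_coeff_ne_zero_of_coeff_map_ne_zero _ hc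
    have hdom := dominated_of_coeff_rationalDunkl_monomial α (Finset.notMem_empty a) hc'
    refine ⟨c, hcf, ?_⟩
    rwa [indicatorExp_insert (Finset.notMem_empty a), indicatorExp, Finset.sum_empty, add_zero,
      add_zero, Finsupp.sub_add_single_one_cancel (Finsupp.mem_support_iff.1 ha)] at hdom
  · exact absurd rfl hc

theorem coeff_dunkl_eq_zero (α : K) {a : Fin n} (f : MvPolynomial (Fin n) K) {c : Fin n →₀ ℕ}
    (hc : c a = 0) : coeff c (dunkl α a f) = 0 := by
  rw [dunkl_eq_mulBy_mul_rationalDunkl, Module.End.mul_apply, mulBy_apply, coeff_X_mul',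
    if_neg (by simpa using hc)]

end Dunkl

section OrderedProducts

/-- The product `E_0(j_0) E_1(j_1) ⋯ E_{k-1}(j_{k-1})` of operators, in this order. -/
def opProd {R σ : Type*} [Monoid R] (E : ℕ → σ → R) {k : ℕ} (j : Fin k → σ) : R :=
  (List.ofFn fun s : Fin k => E s (j s)).prod

theorem opProd_zero {R σ : Type*} [Monoid R] (E : ℕ → σ → R) (j : Fin 0 → σ) :
    opProd E j = 1 := by
  simp [opProd]

theorem opProd_succ {R σ : Type*} [Monoid R] (E : ℕ → σ → R) {k : ℕ} (j : Fin (k + 1) → σ) :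
    opProd E j = E 0 (j 0) * opProd (fun s => E (s + 1)) (j ∘ Fin.succ) := by
  simp [opProd, List.ofFn_succ]

theorem map_opProd {F R S σ : Type*} [Monoid R] [Monoid S] [FunLike F R S]
    [MonoidHomClass F R S] (φ : F) (E : ℕ → σ → R) {k : ℕ} (j : Fin k → σ) :
    φ (opProd E j) = opProd (fun s a => φ (E s a)) j := by
  rw [opProd, opProd, map_list_prod, List.map_ofFn]
  rfl

variable {K : Type*} [Field K] {n : ℕ}

/-- The operator `D_a + s`. -/
def shiftedDunkl (α : K) (s : ℕ) (a : Fin n) : Module.End K (MvPolynomial (Fin n) K) :=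
  dunkl α a + (s : Module.End K (MvPolynomial (Fin n) K))

theorem dunklProd_eq_opProd (α : K) (J : Finset (Fin n)) :
    dunklProd α J = opProd (fun s => shiftedDunkl α (s + 1)) (J.orderEmbOfFin rfl) :=
  rfl

theorem dominated_of_coeff_opProd_rationalDunkl (α : K) {k : ℕ} (j : Fin k ↪ Fin n)
    {f : MvPolynomial (Fin n) K} {c' : Fin n →₀ ℕ}
    (hc : coeff c' (opProd (fun _ => rationalDunkl α) j f) ≠ 0) :
    ∃ c, coeff c f ≠ 0 ∧ Dominated (c' + indicatorExp (Finset.univ.map j)) c := by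
  induction k generalizing c' with
  | zero =>
    rw [opProd_zero] at hc
    exact ⟨c', hc, by simpa [indicatorExp] using .refl _⟩
  | succ k ih =>
    rw [opProd_succ, Module.End.mul_apply] at hc
    obtain ⟨d, hd, hd'⟩ := exists_coeff_ne_zero_of_coeff_map_ne_zero _ hc
    obtain ⟨c, hc, hdom⟩ := ih ((Fin.succEmb k).trans j) hd
    refine ⟨c, hc, .trans ?_ hdom⟩
    have hmap : Finset.univ.map j =
        insert (j 0) (Finset.univ.map ((Fin.succEmb k).trans j)) := by
      ext x
      simp [Fin.exists_fin_succ, eq_comm]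
    rw [hmap]
    exact dominated_of_coeff_rationalDunkl_monomial α (by simp) hd'

/-- The product `T_1 ⋯ T_n` of the operators `T_a` with `D_a = x_a T_a`. -/
def rationalDunklProd (α : K) (n : ℕ) : Module.End K (MvPolynomial (Fin n) K) :=
  opProd (fun _ => rationalDunkl α) id

theorem dominated_of_coeff_rationalDunklProd (α : K) {f : MvPolynomial (Fin n) K}
    {c' : Fin n →₀ ℕ} (hc : coeff c' (rationalDunklProd α n f) ≠ 0) :
    ∃ c, coeff c f ≠ 0 ∧ Dominated (c' + indicatorExp (Finset.univ : Finset (Fin n))) c := by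
  obtain ⟨c, hcf, hdom⟩ := dominated_of_coeff_opProd_rationalDunkl α (.refl (Fin n)) hc
  exact ⟨c, hcf, by rwa [Finset.map_refl] at hdom⟩

theorem dominated_of_coeff_shiftedDunkl (α : K) (s : ℕ) (a : Fin n) {f : MvPolynomial (Fin n) K}
    {c' : Fin n →₀ ℕ} (hc : coeff c' (shiftedDunkl α s a f) ≠ 0) :
    ∃ c, coeff c f ≠ 0 ∧ Dominated c' c := by
  rw [shiftedDunkl, LinearMap.add_apply, coeff_add, natCast_end_apply, coeff_smul] at hc
  by_cases hdunkl : coeff c' (dunkl α a f) = 0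
  · rw [hdunkl, zero_add] at hc
    exact ⟨c', right_ne_zero_of_smul hc, .refl _⟩
  · exact dominated_of_coeff_dunkl α a hdunkl

theorem dominated_of_coeff_opProd_shiftedDunkl (α : K) {k : ℕ} (j : Fin k → Fin n) (u : ℕ → ℕ)
    {f : MvPolynomial (Fin n) K} {c' : Fin n →₀ ℕ}
    (hc : coeff c' (opProd (fun s => shiftedDunkl α (u s)) j f) ≠ 0) :
    ∃ c, coeff c f ≠ 0 ∧ Dominated c' c := by
  induction k generalizing u c' with
  | zero =>
    rw [opProd_zero] at hc
    exact ⟨c', hc, .refl _⟩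
  | succ k ih =>
    rw [opProd_succ, Module.End.mul_apply] at hc
    obtain ⟨d, hd, hdom⟩ := dominated_of_coeff_shiftedDunkl α _ _ hc
    obtain ⟨c, hc, hdom'⟩ := ih _ (fun s => u (s + 1)) hd
    exact ⟨c, hc, hdom.trans hdom'⟩

theorem coeff_opProd_shiftedDunkl (α : K) {k : ℕ} (j : Fin k → Fin n) (u : ℕ → ℕ)
    (f : MvPolynomial (Fin n) K) {c : Fin n →₀ ℕ} (hc : ∀ s, c (j s) = 0) :
    coeff c (opProd (fun s => shiftedDunkl α (u s)) j f) =
      ((∏ s ∈ Finset.range k, u s : ℕ) : K) * coeff c f := by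
  induction k generalizing u with
  | zero => simp [opProd_zero]
  | succ k ih =>
    rw [opProd_succ, Module.End.mul_apply, shiftedDunkl, LinearMap.add_apply, coeff_add,
      coeff_dunkl_eq_zero α _ (hc 0), zero_add, natCast_end_apply, coeff_smul,
      ih (j ∘ Fin.succ) (fun s => u (s + 1)) fun s => hc s.succ, Finset.prod_range_succ']
    push_cast
    rw [smul_eq_mul]
    ring

end OrderedProducts

/-! ### Dunkl operators acting on a kernel -/

section MatchSum

variable {R X Y : Type*} [CommSemiring R] [Fintype Y]

/-- The sum over injections `τ : Fin k ↪ Y` of `∏_s g (j s) (τ s)`. -/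
def matchSum (g : X → Y → R) {k : ℕ} (j : Fin k → X) : R :=
  ∑ τ : Fin k ↪ Y, ∏ s, g (j s) (τ s)

theorem matchSum_zero (g : X → Y → R) (j : Fin 0 → X) : matchSum g j = 1 := by
  simp [matchSum]

theorem matchSum_succ [DecidableEq Y] (g : X → Y → R) {k : ℕ} (j : Fin (k + 1) → X) :
    matchSum g j = ∑ τ : Fin k ↪ Y,
      (∑ y ∈ (Finset.univ.map τ)ᶜ, g (j 0) y) * ∏ s : Fin k, g (j s.succ) (τ s) := by
  rw [matchSum, ← (Equiv.embeddingFinSucc k Y).symm.sum_comp, Fintype.sum_sigma]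
  refine Finset.sum_congr rfl fun τ _ => ?_
  rw [Finset.sum_mul, Finset.sum_subtype (p := (· ∉ Set.range τ)) (Finset.univ.map τ)ᶜ
    (by simp) fun y => g (j 0) y * ∏ s : Fin k, g (j s.succ) (τ s)]
  refine Finset.sum_congr rfl fun y _ => ?_
  simp [Fin.prod_univ_succ]

theorem matchSum_eq_sum_perm {i : ℕ} (g : X → Fin i → R) (j : Fin i → X) :
    matchSum g j = ∑ π : Equiv.Perm (Fin i), ∏ k, g (j (π k)) k := by
  rw [matchSum, ← (Equiv.embeddingEquivOfFinite (Fin i)).symm.sum_comp,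
    ← Equiv.sum_comp (Equiv.inv (Equiv.Perm (Fin i)))]
  refine Finset.sum_congr rfl fun π _ => ?_
  rw [← Equiv.prod_comp π]
  simp

theorem sum_embedding_map_univ_eq {M : Type*} [AddCommMonoid M] [Fintype X] [DecidableEq X]
    {i : ℕ} (F : (Fin i ↪ X) → M) (j : Fin i ↪ X) :
    ∑ τ : Fin i ↪ X with Finset.univ.map τ = Finset.univ.map j, F τ =
      ∑ π : Equiv.Perm (Fin i), F (π.toEmbedding.trans j) := by
  symm
  refine Finset.sum_bij (fun π _ => π.toEmbedding.trans j) (fun π _ => ?_) (fun π _ π' _ h => ?_)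
    (fun τ hτ => ?_) fun π _ => rfl
  · simp [← Finset.map_map]
  · ext k : 1
    exact j.injective (DFunLike.congr_fun h k)
  · have hmem (k : Fin i) : ∃ l, j l = τ k := by
      simpa using (Finset.mem_filter.1 hτ).2.le (Finset.mem_map_of_mem τ (Finset.mem_univ k))
    choose π hπ using hmem
    have hinj : π.Injective := fun k l hkl => τ.injective (by rw [← hπ, ← hπ, hkl])
    exact ⟨.ofBijective π (Finite.injective_iff_bijective.1 hinj), Finset.mem_univ _,
      DFunLike.ext _ _ hπ⟩

theorem sum_powersetCard_matchSum [Fintype X] [LinearOrder X] {i : ℕ} (g : X → Fin i → R) :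
    ∑ J ∈ Finset.powersetCard i Finset.univ, matchSum g (J.orderEmbOfFin rfl) =
      matchSum (Function.swap g) id := by
  have hcard (τ : Fin i ↪ X) : Finset.univ.map τ ∈ Finset.powersetCard i Finset.univ := by
    simp [Finset.mem_powersetCard]
  rw [matchSum, ← Finset.sum_fiberwise_of_maps_to fun τ _ => hcard τ]
  refine Finset.sum_congr rfl fun J hJ => ?_
  obtain rfl := (Finset.mem_powersetCard.1 hJ).2
  have hmap : Finset.univ.map (J.orderEmbOfFin rfl).toEmbedding = J :=
    Finset.map_orderEmbOfFin_univ J rfl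
  have hfiber := sum_embedding_map_univ_eq (fun τ => ∏ k, g (τ k) k)
    (J.orderEmbOfFin rfl).toEmbedding
  rw [hmap] at hfiber
  exact (matchSum_eq_sum_perm g _).trans hfiber.symm

end MatchSum

/-- A commutative algebra with the operators that make up the rational Dunkl operators in the
`x_a`, together with a kernel whose logarithmic derivatives are `∑_y v_y / (1 - x_a v_y)`. The
element `geom a y` plays the role of `1 / (1 - x_a v_y)`. -/
structure KernelSystem (K R X Y : Type*) [CommRing K] [CommRing R] [Algebra K R] [Fintype Y] where
  x : X → R
  v : Y → R
  geom : X → Y → R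
  kernel : R
  der : X → Derivation K R R
  exch : X → X → R →ₐ[K] R
  divDiff : X → X → Module.End K R
  sub_mul_divDiff : ∀ a b, a ≠ b → ∀ F, (x a - x b) * divDiff a b F = F - exch a b F
  sub_mul_eq_zero : ∀ a b, a ≠ b → ∀ F, (x a - x b) * F = 0 → F = 0
  geom_eq : ∀ a y, geom a y = 1 + x a * v y * geom a y
  exch_geom : ∀ a b y, exch a b (geom b y) = geom a y
  exch_geom_of_ne : ∀ a b c y, c ≠ a → c ≠ b → exch a b (geom c y) = geom c y
  exch_v : ∀ a b y, exch a b (v y) = v y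
  exch_kernel : ∀ a b, exch a b kernel = kernel
  der_geom : ∀ a b y, b ≠ a → der a (geom b y) = 0
  der_v : ∀ a y, der a (v y) = 0
  der_kernel : ∀ a, der a kernel = (∑ y, v y * geom a y) * kernel

theorem derivation_prod_eq_zero {K R ι : Type*} [CommRing K] [CommRing R] [Algebra K R]
    (D : Derivation K R R) {s : Finset ι} {g : ι → R} (hg : ∀ i ∈ s, D (g i) = 0) :
    D (∏ i ∈ s, g i) = 0 := by
  refine Finset.prod_induction g (D · = 0) (fun p q hp hq => ?_) D.map_one_eq_zero hg
  rw [D.leibniz, hp, hq, smul_zero, smul_zero, add_zero]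

namespace KernelSystem

variable {K R X Y : Type*} [CommRing K] [CommRing R] [Algebra K R] [Fintype Y]
  (S : KernelSystem K R X Y)

theorem divDiff_eq {a b : X} (h : a ≠ b) {F G : R}
    (hG : (S.x a - S.x b) * G = F - S.exch a b F) : S.divDiff a b F = G := by
  refine sub_eq_zero.1 (S.sub_mul_eq_zero a b h _ ?_)
  rw [mul_sub, S.sub_mul_divDiff a b h, hG, sub_self]

theorem divDiff_mul {a b : X} (h : a ≠ b) (F : R) {G : R} (hG : S.exch a b G = G) :
    S.divDiff a b (F * G) = S.divDiff a b F * G := by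
  apply S.divDiff_eq h
  rw [← mul_assoc, S.sub_mul_divDiff a b h, map_mul, hG, sub_mul]

theorem divDiff_eq_zero {a b : X} (h : a ≠ b) {F : R} (hF : S.exch a b F = F) :
    S.divDiff a b F = 0 :=
  S.divDiff_eq h (by rw [hF, sub_self, mul_zero])

theorem divDiff_geom {a b : X} (h : a ≠ b) (y : Y) :
    S.divDiff a b (S.geom b y) = -(S.v y * S.geom a y) * S.geom b y := by
  apply S.divDiff_eq h
  rw [S.exch_geom]
  linear_combination S.geom b y * S.geom_eq a y - S.geom a y * S.geom_eq b y

theorem x_mul_sum_v_mul_geom (a : X) (T : Finset Y) :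
    S.x a * ∑ y ∈ T, S.v y * S.geom a y = ∑ y ∈ T, S.geom a y - T.card := by
  have hx (y : Y) : S.x a * (S.v y * S.geom a y) = S.geom a y - 1 := by
    linear_combination -S.geom_eq a y
  simp only [Finset.mul_sum, hx, Finset.sum_sub_distrib, Finset.sum_const, nsmul_one]

section ProdGeom

variable {a : X} {k : ℕ} (j : Fin k ↪ X) (τ : Fin k → Y)

theorem divDiff_prod_geom (ha : a ∉ Set.range j) (s : Fin k) :
    S.divDiff a (j s) (∏ s, S.geom (j s) (τ s)) =
      -(S.v (τ s) * S.geom a (τ s)) * ∏ s, S.geom (j s) (τ s) := by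
  have hne (s : Fin k) : j s ≠ a := fun hs => ha ⟨s, hs⟩
  have hrest : S.exch a (j s) (∏ t ∈ Finset.univ.erase s, S.geom (j t) (τ t)) =
      ∏ t ∈ Finset.univ.erase s, S.geom (j t) (τ t) := by
    rw [map_prod]
    exact Finset.prod_congr rfl fun t ht =>
      S.exch_geom_of_ne _ _ _ _ (hne t) (j.injective.ne (Finset.ne_of_mem_erase ht))
  rw [← Finset.mul_prod_erase Finset.univ _ (Finset.mem_univ s),
    S.divDiff_mul (hne s).symm _ hrest, S.divDiff_geom (hne s).symm, mul_assoc]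

theorem divDiff_prod_geom_of_notMem (ha : a ∉ Set.range j) {b : X} (hab : a ≠ b)
    (hb : b ∉ Set.range j) : S.divDiff a b (∏ s, S.geom (j s) (τ s)) = 0 := by
  apply S.divDiff_eq_zero hab
  rw [map_prod]
  exact Finset.prod_congr rfl fun s _ =>
    S.exch_geom_of_ne _ _ _ _ (fun h => ha ⟨s, h⟩) fun h => hb ⟨s, h⟩

end ProdGeom

variable [Fintype X] [DecidableEq X]

/-- The operator `∂_a + ∑_{b ≠ a} 1 / (x_a - x_b) (1 - K_{ab})`. -/
def dunklOp (a : X) : Module.End K R :=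
  (S.der a).toLinearMap + ∑ b ∈ Finset.univ.erase a, S.divDiff a b

theorem dunklOp_apply (a : X) (F : R) :
    S.dunklOp a F = S.der a F + ∑ b ∈ Finset.univ.erase a, S.divDiff a b F := by
  rw [dunklOp, LinearMap.add_apply, LinearMap.sum_apply, Derivation.coeFn_coe]

theorem dunklOp_mul (a : X) (F : R) {G : R} (hG : ∀ b, S.exch a b G = G) :
    S.dunklOp a (F * G) = S.dunklOp a F * G + F * S.der a G := by
  rw [dunklOp_apply, dunklOp_apply, Finset.sum_congr rfl fun b hb =>
    S.divDiff_mul (Finset.ne_of_mem_erase hb).symm F (hG b), ← Finset.sum_mul,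
    Derivation.leibniz, smul_eq_mul, smul_eq_mul]
  ring

theorem dunklOp_prod_geom {a : X} {k : ℕ} {j : Fin k ↪ X} (ha : a ∉ Set.range j)
    (τ : Fin k → Y) :
    S.dunklOp a (∏ s, S.geom (j s) (τ s)) =
      -(∑ s, S.v (τ s) * S.geom a (τ s)) * ∏ s, S.geom (j s) (τ s) := by
  have hder : S.der a (∏ s, S.geom (j s) (τ s)) = 0 :=
    derivation_prod_eq_zero _ fun s _ => S.der_geom a _ _ fun h => ha ⟨s, h⟩
  have hsub : Finset.univ.map j ⊆ Finset.univ.erase a := by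
    intro b hb
    obtain ⟨s, -, rfl⟩ := Finset.mem_map.1 hb
    exact Finset.mem_erase.2 ⟨fun h => ha ⟨s, h⟩, Finset.mem_univ _⟩
  rw [dunklOp_apply, hder, zero_add, ← Finset.sum_subset hsub fun b hb hbj =>
      S.divDiff_prod_geom_of_notMem j τ ha (Finset.ne_of_mem_erase hb).symm (by simpa using hbj),
    Finset.sum_map, Finset.sum_congr rfl fun s _ => S.divDiff_prod_geom j τ ha s,
    ← Finset.sum_mul, Finset.sum_neg_distrib]

theorem dunklOp_prod_v_mul (a : X) {k : ℕ} (τ : Fin k → Y) (F : R) :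
    S.dunklOp a ((∏ s, S.v (τ s)) * F) = (∏ s, S.v (τ s)) * S.dunklOp a F := by
  have hder : S.der a (∏ s, S.v (τ s)) = 0 := derivation_prod_eq_zero _ fun s _ => S.der_v a _
  have hexch (b : X) : S.exch a b (∏ s, S.v (τ s)) = ∏ s, S.v (τ s) := by
    rw [map_prod, Finset.prod_congr rfl fun s _ => S.exch_v a b (τ s)]
  rw [mul_comm, S.dunklOp_mul a F hexch, hder, mul_zero, add_zero, mul_comm]

theorem dunklOp_prod_geom_mul_kernel [DecidableEq Y] {a : X} {k : ℕ} {j : Fin k ↪ X}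
    (ha : a ∉ Set.range j) (τ : Fin k ↪ Y) :
    S.dunklOp a ((∏ s, S.geom (j s) (τ s)) * S.kernel) =
      (∑ y ∈ (Finset.univ.map τ)ᶜ, S.v y * S.geom a y) *
        ((∏ s, S.geom (j s) (τ s)) * S.kernel) := by
  have hsum := Finset.sum_add_sum_compl (Finset.univ.map τ) fun y => S.v y * S.geom a y
  rw [Finset.sum_map] at hsum
  rw [S.dunklOp_mul a _ (S.exch_kernel a), S.dunklOp_prod_geom ha, S.der_kernel, ← hsum]
  ring

theorem opProd_dunklOp_kernel {k : ℕ} (j : Fin k ↪ X) :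
    opProd (fun _ => S.dunklOp) j S.kernel =
      matchSum (fun a y => S.v y * S.geom a y) j * S.kernel := by
  classical
  induction k with
  | zero => simp [opProd_zero, matchSum_zero]
  | succ k ih =>
    have h0 : j 0 ∉ Set.range ((Fin.succEmb k).trans j) := by simp [Fin.succ_ne_zero]
    rw [opProd_succ, Module.End.mul_apply, ← Fin.coe_succEmb, ← Function.Embedding.coe_trans,
      ih, matchSum_succ, matchSum, Finset.sum_mul, Finset.sum_mul, map_sum]
    refine Finset.sum_congr rfl fun τ _ => ?_
    rw [Finset.prod_mul_distrib, mul_assoc, S.dunklOp_prod_v_mul,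
      S.dunklOp_prod_geom_mul_kernel h0]
    simp only [Function.Embedding.trans_apply, Fin.coe_succEmb, Finset.prod_mul_distrib]
    ring

/-- Since `x_a v_y / (1 - x_a v_y) = 1 / (1 - x_a v_y) - 1`, the shift by `card Y - k` is what
turns the numerators `v_y` of `dunklOp_prod_geom_mul_kernel` into `1`. -/
theorem x_mul_dunklOp_add_prod_geom_mul_kernel [DecidableEq Y] {a : X} {k : ℕ}
    {j : Fin k ↪ X} (ha : a ∉ Set.range j) (τ : Fin k ↪ Y) {u : ℕ} (hu : u + k = Fintype.card Y) :
    S.x a * S.dunklOp a ((∏ s, S.geom (j s) (τ s)) * S.kernel) +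
        u * ((∏ s, S.geom (j s) (τ s)) * S.kernel) =
      (∑ y ∈ (Finset.univ.map τ)ᶜ, S.geom a y) * ((∏ s, S.geom (j s) (τ s)) * S.kernel) := by
  have hcard : (Finset.univ.map τ)ᶜ.card = u := by
    rw [Finset.card_compl, Finset.card_map, Finset.card_univ, Fintype.card_fin]
    omega
  have hx := S.x_mul_sum_v_mul_geom a (Finset.univ.map τ)ᶜ
  rw [hcard] at hx
  rw [S.dunklOp_prod_geom_mul_kernel ha, ← mul_assoc, hx]
  ring

theorem opProd_mul_dunklOp_kernel {k : ℕ} (j : Fin k ↪ X) {u : ℕ}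
    (hu : u + k = Fintype.card Y) :
    opProd (fun s a => Algebra.lmul K R (S.x a) * S.dunklOp a +
        ((u + s + 1 : ℕ) : Module.End K R)) j S.kernel = matchSum S.geom j * S.kernel := by
  classical
  induction k generalizing u with
  | zero => simp [opProd_zero, matchSum_zero]
  | succ k ih =>
    have h0 : j 0 ∉ Set.range ((Fin.succEmb k).trans j) := by simp [Fin.succ_ne_zero]
    have ih' := ih ((Fin.succEmb k).trans j) (u := u + 1) (by omega)
    simp only [add_right_comm u 1, add_assoc u] at ih'
    rw [opProd_succ, Module.End.mul_apply, ← Fin.coe_succEmb, ← Function.Embedding.coe_trans]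
    simp only [add_assoc u]
    rw [ih', matchSum_succ, matchSum, Finset.sum_mul, Finset.sum_mul, map_sum]
    refine Finset.sum_congr rfl fun τ _ => ?_
    have hstep := S.x_mul_dunklOp_add_prod_geom_mul_kernel h0 τ (u := u + 1) (by omega)
    rw [LinearMap.add_apply, Module.End.mul_apply, Algebra.coe_lmul_eq_mul, LinearMap.mul_apply',
      Module.End.natCast_apply, nsmul_eq_mul]
    simpa only [zero_add, mul_assoc, Function.Embedding.trans_apply, Fin.coe_succEmb] using hstep

end KernelSystem

/-! ### The reproducing kernel of the scalar product -/

section Size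

/-- The size `∑ k m_k` of the partition with `m k` parts equal to `k`. -/
def size : (ℕ+ →₀ ℕ) →+ ℕ :=
  Finsupp.weight fun k : ℕ+ => (k : ℕ)

theorem size_single (k : ℕ+) (c : ℕ) : size (Finsupp.single k c) = c * k := by
  rw [size, Finsupp.weight_single, smul_eq_mul]

theorem finite_size_eq (N : ℕ) : {m : ℕ+ →₀ ℕ | size m = N}.Finite := by
  refine (Set.finite_Iic (∑ k ∈ Finset.Iic (Nat.succPNat N), Finsupp.single k N)).subset ?_
  rintro m rfl k
  rcases eq_or_ne (m k) 0 with hk | hk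
  · simp [hk]
  · have hkN : k ∈ Finset.Iic (Nat.succPNat (size m)) := by
      rw [Finset.mem_Iic, ← PNat.coe_le_coe, Nat.succPNat_coe]
      exact (Finsupp.le_weight_of_ne_zero' (fun k : ℕ+ => (k : ℕ)) hk).trans (Nat.le_succ _)
    have hmk : m k ≤ size m := Finsupp.le_weight (fun k : ℕ+ => (k : ℕ)) k.pos.ne' m
    classical
    rw [Finsupp.finsetSum_apply]
    simpa [Finsupp.single_apply, -Finset.mem_Iic, hkN] using hmk

/-- The partitions of `N`, given by their multiplicities. -/
def sizeSet (N : ℕ) : Finset (ℕ+ →₀ ℕ) :=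
  (finite_size_eq N).toFinset

theorem mem_sizeSet {N : ℕ} {m : ℕ+ →₀ ℕ} : m ∈ sizeSet N ↔ size m = N := by
  simp [sizeSet]

theorem sum_sizeSet_sum_support {M : Type*} [AddCommMonoid M] (F : ℕ+ → (ℕ+ →₀ ℕ) → M)
    (N : ℕ) :
    ∑ m ∈ sizeSet N, ∑ r ∈ m.support, F r (m - Finsupp.single r 1) =
      ∑ p ∈ Finset.HasAntidiagonal.antidiagonal N with p.1 ≠ 0,
        ∑ m ∈ sizeSet p.2, F p.1.toPNat' m := by
  rw [Finset.sum_sigma', Finset.sum_sigma']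
  refine Finset.sum_bij' (fun q _ => ⟨((q.2 : ℕ), N - q.2), q.1 - Finsupp.single q.2 1⟩)
    (fun q _ => ⟨q.2 + Finsupp.single q.1.1.toPNat' 1, q.1.1.toPNat'⟩) ?_ ?_ ?_ ?_ ?_
  · rintro ⟨m, r⟩ hq
    simp only [Finset.mem_sigma, mem_sizeSet, Finsupp.mem_support_iff, Finset.mem_filter,
      Finset.HasAntidiagonal.mem_antidiagonal] at hq ⊢
    have hsize : size (m - Finsupp.single r 1) + r = N := by
      conv_rhs => rw [← hq.1, ← Finsupp.sub_add_single_one_cancel hq.2, map_add, size_single,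
        one_mul]
    exact ⟨⟨by omega, r.pos.ne'⟩, by omega⟩
  · rintro ⟨⟨r, s⟩, m⟩ hq
    simp only [Finset.mem_sigma, mem_sizeSet, Finsupp.mem_support_iff, Finset.mem_filter,
      Finset.HasAntidiagonal.mem_antidiagonal, map_add, size_single, Nat.toPNat'_coe] at hq ⊢
    rw [if_pos (Nat.pos_of_ne_zero hq.1.2)]
    exact ⟨by omega, by simp⟩
  · rintro ⟨m, r⟩ hq
    simp only [Finset.mem_sigma, Finsupp.mem_support_iff] at hq
    simp [Finsupp.sub_add_single_one_cancel hq.2]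
  · rintro ⟨⟨r, s⟩, m⟩ hq
    simp only [Finset.mem_sigma, Finset.mem_filter, Finset.HasAntidiagonal.mem_antidiagonal] at hq
    have hs : N - r = s := by omega
    simp [Nat.pos_of_ne_zero hq.1.2, hs]
  · rintro ⟨m, r⟩ _
    simp

end Size

section PowerSums

theorem zed_add_single (m : ℕ+ →₀ ℕ) (r : ℕ+) :
    zed (m + Finsupp.single r 1) = (m r + 1) * r * zed m := by
  have hzed (m : ℕ+ →₀ ℕ) : zed m = (r : ℕ) ^ m r * (m r).factorial * zed (m.erase r) :=
    (Finsupp.mul_prod_erase' m r (fun (k : ℕ+) c => (k : ℕ) ^ c * c.factorial) (by simp)).symm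
  rw [hzed, hzed m, Finsupp.erase_add, Finsupp.erase_single, add_zero, Finsupp.add_apply,
    Finsupp.single_eq_same, pow_succ, Nat.factorial_succ]
  ring

theorem zed_ne_zero (m : ℕ+ →₀ ℕ) : zed m ≠ 0 :=
  Finset.prod_ne_zero_iff.2 fun k _ =>
    mul_ne_zero (pow_ne_zero _ k.pos.ne') (Nat.factorial_ne_zero _)

variable {K : Type*} [Field K]

/-- The value `z_μ α ^ ℓ(μ)` of `⟨p_μ, p_μ⟩`. -/
def psumNorm (α : K) (m : ℕ+ →₀ ℕ) : K :=
  (zed m : K) * α ^ m.degree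

theorem psumNorm_ne_zero [CharZero K] {α : K} (hα : α ≠ 0) (m : ℕ+ →₀ ℕ) : psumNorm α m ≠ 0 :=
  mul_ne_zero (Nat.cast_ne_zero.2 (zed_ne_zero m)) (pow_ne_zero _ hα)

theorem psumNorm_add_single (α : K) (m : ℕ+ →₀ ℕ) (r : ℕ+) :
    psumNorm α (m + Finsupp.single r 1) = α * (m r + 1 : ℕ) * (r : ℕ) * psumNorm α m := by
  rw [psumNorm, psumNorm, zed_add_single, map_add, Finsupp.degree_single, pow_succ]
  push_cast
  ring

theorem toVars_X (n : ℕ) (r : ℕ+) : toVars n (X r : SymFun K) = psum (Fin n) K r :=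
  aeval_X _ r

/-- The product `p_μ(x_1, …, x_n)` of power sums. -/
def psumProd (K : Type*) [Field K] (n : ℕ) (m : ℕ+ →₀ ℕ) : MvPolynomial (Fin n) K :=
  toVars n (monomial m 1)

theorem psumProd_add_single (n : ℕ) (m : ℕ+ →₀ ℕ) (r : ℕ+) :
    psumProd K n (m + Finsupp.single r 1) = psum (Fin n) K r * psumProd K n m := by
  rw [psumProd, psumProd, ← toVars_X, ← map_mul, X, monomial_mul, one_mul, add_comm]

theorem rename_toVars {n : ℕ} (e : Equiv.Perm (Fin n)) (f : SymFun K) :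
    rename e (toVars n f) = toVars n f := by
  have h : (rename e).comp (toVars n) = toVars (K := K) n := by
    apply algHom_ext
    intro r
    rw [AlgHom.comp_apply, toVars_X, rename_psum]
  exact DFunLike.congr_fun h f

theorem pderiv_psum (n : ℕ) (a : Fin n) (r : ℕ+) :
    pderiv a (psum (Fin n) K r) = ((r : ℕ) : K) • X a ^ ((r : ℕ) - 1) := by
  rw [psum, map_sum, Finset.sum_eq_single a (fun b _ hb => by simp [pderiv_X_of_ne hb]) (by simp)]
  simp [Algebra.smul_def]

theorem derivation_aeval {R A σ : Type*} [CommRing R] [CommRing A] [Algebra R A]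
    (D : Derivation R A A) (g : σ → A) {f : MvPolynomial σ R} {s : Finset σ} (hs : f.vars ⊆ s) :
    D (aeval g f) = ∑ r ∈ s, aeval g (pderiv r f) * D (g r) := by
  classical
  have hf : f ∈ supported R (s : Set σ) := mem_supported.2 (Finset.coe_subset.2 hs)
  clear hs
  rw [supported] at hf
  induction hf using Algebra.adjoin_induction with
  | mem _ h =>
    obtain ⟨r, hr, rfl⟩ := h
    rw [aeval_X, Finset.sum_eq_single_of_mem r hr fun t _ ht => by simp [pderiv_X_of_ne ht.symm]]
    simp
  | algebraMap c => simp
  | add p q _ _ hp hq =>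
    simp only [map_add, hp, hq, add_mul, Finset.sum_add_distrib]
  | mul p q _ _ hp hq =>
    rw [map_mul, D.leibniz, hp, hq, smul_eq_mul, smul_eq_mul, Finset.mul_sum, Finset.mul_sum,
      ← Finset.sum_add_distrib]
    refine Finset.sum_congr rfl fun r _ => ?_
    rw [pderiv_mul, map_add, map_mul, map_mul]
    ring

theorem pderiv_toVars (n : ℕ) (a : Fin n) {f : SymFun K} {s : Finset ℕ+} (hs : f.vars ⊆ s) :
    pderiv a (toVars n f) =
      ∑ r ∈ s, ((r : ℕ) : K) • (X a ^ ((r : ℕ) - 1) * toVars n (pderiv r f)) := by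
  rw [toVars, derivation_aeval (pderiv a) _ hs]
  refine Finset.sum_congr rfl fun r _ => ?_
  rw [pderiv_psum, mul_smul_comm, mul_comm]

theorem pderiv_psumProd (n : ℕ) (a : Fin n) (m : ℕ+ →₀ ℕ) :
    pderiv a (psumProd K n m) = ∑ r ∈ m.support, ((m r : K) * (r : ℕ)) •
      (X a ^ ((r : ℕ) - 1) * psumProd K n (m - Finsupp.single r 1)) := by
  have hvars : (monomial m (1 : K)).vars ⊆ m.support := (vars_monomial one_ne_zero).subset
  rw [psumProd, pderiv_toVars n a hvars]
  refine Finset.sum_congr rfl fun r _ => ?_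
  rw [pderiv_monomial, one_mul, psumProd, ← mul_one (m r : K), ← smul_eq_mul (m r : K) 1,
    ← smul_monomial, map_smul, mul_smul_comm, smul_smul, smul_eq_mul, mul_one, mul_comm (m r : K)]

end PowerSums

section Kernel

variable {K : Type*} [Field K]

/-- The component of degree `N` of the reproducing kernel
`∏_{a, k} (1 - x_a y_k)^(-1/α) = ∑_μ ⟨p_μ, p_μ⟩⁻¹ p_μ(x) p_μ(y)`. -/
def kernelTerm (α : K) (n i N : ℕ) : MvPolynomial (Fin n) K ⊗[K] MvPolynomial (Fin i) K :=
  ∑ m ∈ sizeSet N, (psumNorm α m)⁻¹ • (psumProd K n m ⊗ₜ psumProd K i m)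

theorem pderiv_smul_psumProd_tmul [CharZero K] {α : K} (hα : α ≠ 0) (n i : ℕ) (a : Fin n)
    (m : ℕ+ →₀ ℕ) :
    (α • (pderiv a).toLinearMap).rTensor (MvPolynomial (Fin i) K)
        ((psumNorm α m)⁻¹ • (psumProd K n m ⊗ₜ[K] psumProd K i m)) =
      ∑ r ∈ m.support, ((X a ^ ((r : ℕ) - 1)) ⊗ₜ psum (Fin i) K r) *
        ((psumNorm α (m - Finsupp.single r 1))⁻¹ •
          (psumProd K n (m - Finsupp.single r 1) ⊗ₜ psumProd K i (m - Finsupp.single r 1))) := by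
  rw [map_smul, LinearMap.rTensor_tmul, LinearMap.smul_apply, Derivation.coeFn_coe,
    pderiv_psumProd, Finset.smul_sum, sum_tmul, Finset.smul_sum]
  refine Finset.sum_congr rfl fun r hr => ?_
  obtain ⟨m, rfl⟩ : ∃ m', m = m' + Finsupp.single r 1 :=
    ⟨_, (Finsupp.sub_add_single_one_cancel (Finsupp.mem_support_iff.1 hr)).symm⟩
  have hm : ((m r + 1 : ℕ) : K) ≠ 0 := Nat.cast_ne_zero.2 (Nat.succ_ne_zero _)
  have hr : ((r : ℕ) : K) ≠ 0 := Nat.cast_ne_zero.2 r.pos.ne'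
  have hnorm := psumNorm_ne_zero hα m
  rw [add_tsub_cancel_right, psumProd_add_single, psumNorm_add_single, mul_smul_comm,
    Algebra.TensorProduct.tmul_mul_tmul, smul_smul, ← smul_tmul', smul_smul,
    Finsupp.add_apply, Finsupp.single_eq_same]
  congr 1
  field_simp

theorem pderiv_kernelTerm [CharZero K] {α : K} (hα : α ≠ 0) (n i N : ℕ) (a : Fin n) :
    (α • (pderiv a).toLinearMap).rTensor (MvPolynomial (Fin i) K) (kernelTerm α n i N) =
      ∑ p ∈ Finset.HasAntidiagonal.antidiagonal N with p.1 ≠ 0,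
        ((X a ^ (p.1 - 1)) ⊗ₜ psum (Fin i) K p.1) * kernelTerm α n i p.2 := by
  rw [kernelTerm, map_sum, Finset.sum_congr rfl fun m _ => pderiv_smul_psumProd_tmul hα n i a m,
    sum_sizeSet_sum_support fun r m => ((X a ^ ((r : ℕ) - 1)) ⊗ₜ psum (Fin i) K r) *
      ((psumNorm α m)⁻¹ • (psumProd K n m ⊗ₜ psumProd K i m))]
  refine Finset.sum_congr rfl fun p hp => ?_
  have hp : 0 < p.1 := Nat.pos_of_ne_zero (Finset.mem_filter.1 hp).2
  rw [kernelTerm, Finset.mul_sum, Nat.toPNat'_coe, if_pos hp]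

/-- The reproducing kernel, graded by the variable of the power series. -/
def kernelSeries (α : K) (n i : ℕ) :
    PowerSeries (MvPolynomial (Fin n) K ⊗[K] MvPolynomial (Fin i) K) :=
  PowerSeries.mk (kernelTerm α n i)

end Kernel

/-! ### The Dunkl operators on the kernel -/

section Coeffwise

variable {K : Type*} [Field K] {A B P : Type*} [CommRing A] [Algebra K A] [CommRing B] [Algebra K B]
  [CommRing P] [Algebra K P]

theorem rTensor_derivation_mul (D : Derivation K A A) (p q : A ⊗[K] B) :
    D.toLinearMap.rTensor B (p * q) =
      p * D.toLinearMap.rTensor B q + q * D.toLinearMap.rTensor B p := by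
  induction p with
  | zero => simp
  | add p p' hp hp' => rw [add_mul, map_add, hp, hp', map_add]; ring
  | tmul a b =>
    induction q with
    | zero => simp
    | add q q' hq hq' => rw [mul_add, map_add, hq, hq', map_add]; ring
    | tmul c d =>
      simp only [Algebra.TensorProduct.tmul_mul_tmul, LinearMap.rTensor_tmul,
        Derivation.coeFn_coe, Derivation.leibniz, smul_eq_mul, add_tmul, mul_comm d b]

/-- The linear operators on power series, for the module structure of the algebra `P⟦X⟧` (rather
than the coefficientwise one, which agrees with it only after unfolding). -/
abbrev SeriesEnd (K P : Type*) [Field K] [CommRing P] [Algebra K P] : Type _ :=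
  @Module.End K (PowerSeries P) _ _ Algebra.toModule

/-- A linear operator acting on the coefficients of power series. -/
def coeffwise (P : Type*) [CommRing P] [Algebra K P] : Module.End K P →+* SeriesEnd K P where
  toFun L :=
    { toFun := fun F => PowerSeries.mk fun N => L (PowerSeries.coeff N F)
      map_add' := fun F G => by ext N; simp
      map_smul' := fun c F => PowerSeries.ext fun N => by
        rw [PowerSeries.coeff_mk]
        exact (map_smul L c _).trans
          (congrArg (c • ·) (PowerSeries.coeff_mk N fun N => L (PowerSeries.coeff N F))).symm }
  map_one' := by ext F N; simp
  map_mul' L L' := by ext F N; simp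
  map_zero' := by ext F N; simp
  map_add' L L' := by ext F N; simp

theorem coeff_coeffwise (L : Module.End K P) (F : PowerSeries P) (N : ℕ) :
    PowerSeries.coeff N (coeffwise P L F) = L (PowerSeries.coeff N F) :=
  PowerSeries.coeff_mk N fun N => L (PowerSeries.coeff N F)

theorem coeffwise_mul_of_leibniz {D : Module.End K P}
    (hD : ∀ p q, D (p * q) = p * D q + q * D p) (F G : PowerSeries P) :
    coeffwise P D (F * G) = F * coeffwise P D G + G * coeffwise P D F := by
  ext N
  rw [mul_comm G, coeff_coeffwise, map_add, PowerSeries.coeff_mul, PowerSeries.coeff_mul,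
    PowerSeries.coeff_mul, map_sum, ← Finset.sum_add_distrib]
  refine Finset.sum_congr rfl fun q _ => ?_
  rw [hD, coeff_coeffwise, coeff_coeffwise, mul_comm (PowerSeries.coeff q.2 G)]

end Coeffwise

section KernelSeries

variable {K : Type*} [Field K] {n i : ℕ}

/-- The power series in a variable `t` over `K[x_1, …, x_n] ⊗ K[y_1, …, y_i]`. -/
abbrev BiSeries (K : Type*) [Field K] (n i : ℕ) : Type _ :=
  PowerSeries (MvPolynomial (Fin n) K ⊗[K] MvPolynomial (Fin i) K)

/-- An operator on polynomials in `x`, acting on `K[x] ⊗ K[y]⟦t⟧`. -/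
def liftOp (n i : ℕ) : Module.End K (MvPolynomial (Fin n) K) →+*
    SeriesEnd K (MvPolynomial (Fin n) K ⊗[K] MvPolynomial (Fin i) K) :=
  (coeffwise _).comp (Module.End.rTensorAlgHom K (MvPolynomial (Fin n) K)
    (MvPolynomial (Fin i) K)).toRingHom

theorem coeff_liftOp (N : ℕ) (L : Module.End K (MvPolynomial (Fin n) K)) (F : BiSeries K n i) :
    PowerSeries.coeff N (liftOp n i L F) =
      L.rTensor (MvPolynomial (Fin i) K) (PowerSeries.coeff N F) :=
  coeff_coeffwise _ F N

theorem liftOp_mulBy_apply (p : MvPolynomial (Fin n) K) (F : BiSeries K n i) :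
    liftOp n i (mulBy p) F = PowerSeries.C (p ⊗ₜ 1) * F := by
  have hp : (mulBy p).rTensor (MvPolynomial (Fin i) K) = LinearMap.mulLeft K (p ⊗ₜ 1) := by
    ext a b
    simp
  ext N
  rw [coeff_liftOp, PowerSeries.coeff_C_mul, hp, LinearMap.mulLeft_apply]

/-- A derivation of `K[x]`, acting on `K[x] ⊗ K[y]⟦t⟧`. -/
def liftDerivation (n i : ℕ) (D : Derivation K (MvPolynomial (Fin n) K) (MvPolynomial (Fin n) K)) :
    Derivation K (BiSeries K n i) (BiSeries K n i) :=
  Derivation.mk' (liftOp n i D.toLinearMap)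
    (coeffwise_mul_of_leibniz (rTensor_derivation_mul D))

theorem coeff_liftDerivation (N : ℕ)
    (D : Derivation K (MvPolynomial (Fin n) K) (MvPolynomial (Fin n) K)) (F : BiSeries K n i) :
    PowerSeries.coeff N (liftDerivation n i D F) =
      D.toLinearMap.rTensor (MvPolynomial (Fin i) K) (PowerSeries.coeff N F) :=
  coeff_liftOp N _ F

/-- The exchange of `x_a` and `x_b` on `K[x] ⊗ K[y]⟦t⟧`. -/
def liftExchange (i : ℕ) (a b : Fin n) : BiSeries K n i →ₐ[K] BiSeries K n i :=
  PowerSeries.mapAlgHom (Algebra.TensorProduct.map (exchange a b) (AlgHom.id K _))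

theorem coeff_liftExchange (N : ℕ) (a b : Fin n) (F : BiSeries K n i) :
    PowerSeries.coeff N (liftExchange i a b F) =
      Algebra.TensorProduct.map (exchange a b) (AlgHom.id K _) (PowerSeries.coeff N F) :=
  PowerSeries.coeff_map _ _ _

theorem liftOp_exchange (a b : Fin n) (F : BiSeries K n i) :
    liftOp n i (exchange a b).toLinearMap F = liftExchange i a b F := by
  ext N
  rw [coeff_liftOp, coeff_liftExchange]
  rfl

theorem C_X_sub_X_mul_liftOp_dividedDifference {a b : Fin n} (h : a ≠ b) (F : BiSeries K n i) :
    PowerSeries.C ((X a - X b) ⊗ₜ 1) * liftOp n i (dividedDifference a b h) F =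
      F - liftExchange i a b F := by
  have hdiv : mulBy (X a - X b) * dividedDifference a b h =
      1 - (exchange (K := K) a b).toLinearMap :=
    LinearMap.ext fun f => X_sub_X_mul_dividedDifference h f
  rw [← liftOp_mulBy_apply, ← Module.End.mul_apply, ← map_mul, ← liftOp_exchange, hdiv, map_sub,
    map_one]
  rfl

theorem eq_zero_of_C_X_sub_X_mul_eq_zero {a b : Fin n} (h : a ≠ b) {F : BiSeries K n i}
    (hF : PowerSeries.C ((X a - X b) ⊗ₜ 1) * F = 0) : F = 0 := by
  have hinj : Function.Injective ((mulBy (X a - X b : MvPolynomial (Fin n) K)).rTensor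
      (MvPolynomial (Fin i) K)) :=
    Module.Flat.rTensor_preserves_injective_linearMap _
      (mul_right_injective₀ (X_sub_X_ne_zero h))
  rw [← liftOp_mulBy_apply] at hF
  ext N
  refine (map_eq_zero_iff _ hinj).1 ?_
  rw [← coeff_liftOp, hF, map_zero]

/-- The geometric series `1 / (1 - t x_a y_k)`. -/
def geomSeries (K : Type*) [Field K] {n i : ℕ} (a : Fin n) (k : Fin i) : BiSeries K n i :=
  PowerSeries.mk fun r => (X a ^ r) ⊗ₜ (X k ^ r)

/-- The variable `t y_k`. -/
def scaledVar (K : Type*) [Field K] (n : ℕ) {i : ℕ} (k : Fin i) : BiSeries K n i :=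
  PowerSeries.X * PowerSeries.C (1 ⊗ₜ X k)

theorem coeff_zero_scaledVar_mul (k : Fin i) (F : BiSeries K n i) :
    PowerSeries.coeff 0 (scaledVar K n k * F) = 0 := by
  rw [scaledVar, mul_assoc, PowerSeries.coeff_zero_X_mul]

theorem coeff_succ_scaledVar_mul (N : ℕ) (k : Fin i) (F : BiSeries K n i) :
    PowerSeries.coeff (N + 1) (scaledVar K n k * F) = (1 ⊗ₜ X k) * PowerSeries.coeff N F := by
  rw [scaledVar, mul_assoc, PowerSeries.coeff_succ_X_mul, PowerSeries.coeff_C_mul]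

theorem coeff_scaledVar (N : ℕ) (k : Fin i) :
    PowerSeries.coeff N (scaledVar K n k) = if N = 1 then 1 ⊗ₜ X k else 0 := by
  rw [scaledVar, PowerSeries.coeff_mul_C, PowerSeries.coeff_X, ite_mul, one_mul, zero_mul]

theorem geomSeries_eq (a : Fin n) (k : Fin i) :
    geomSeries K a k =
      1 + PowerSeries.C (X a ⊗ₜ 1) * scaledVar K n k * geomSeries K a k := by
  ext N
  rw [map_add, mul_assoc, PowerSeries.coeff_C_mul]
  cases N with
  | zero =>
    rw [coeff_zero_scaledVar_mul, mul_zero, add_zero]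
    simp [geomSeries, Algebra.TensorProduct.one_def]
  | succ N =>
    rw [coeff_succ_scaledVar_mul, PowerSeries.coeff_one, if_neg N.succ_ne_zero, zero_add]
    simp [geomSeries, Algebra.TensorProduct.tmul_mul_tmul, pow_succ']

theorem liftExchange_geomSeries (a b c : Fin n) (k : Fin i) :
    liftExchange i a b (geomSeries K c k) = geomSeries K (Equiv.swap a b c) k := by
  ext N
  simp [coeff_liftExchange, geomSeries, exchange]

theorem liftExchange_scaledVar (a b : Fin n) (k : Fin i) :
    liftExchange i a b (scaledVar K n k) = scaledVar K n k := by
  ext N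
  rw [coeff_liftExchange, coeff_scaledVar]
  split_ifs <;> simp

theorem liftExchange_kernelSeries (α : K) (a b : Fin n) :
    liftExchange i a b (kernelSeries α n i) = kernelSeries α n i := by
  ext N
  rw [coeff_liftExchange, kernelSeries, PowerSeries.coeff_mk, kernelTerm, map_sum]
  refine Finset.sum_congr rfl fun m _ => ?_
  rw [map_smul, Algebra.TensorProduct.map_tmul, exchange, psumProd, rename_toVars,
    AlgHom.id_apply]

theorem liftDerivation_pderiv_geomSeries (α : K) {a b : Fin n} (h : b ≠ a) (k : Fin i) :
    liftDerivation (K := K) n i (α • pderiv a) (geomSeries K b k) = 0 := by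
  ext N
  rw [coeff_liftDerivation, geomSeries, PowerSeries.coeff_mk, LinearMap.rTensor_tmul]
  simp [pderiv_X_of_ne h]

theorem liftDerivation_scaledVar
    (D : Derivation K (MvPolynomial (Fin n) K) (MvPolynomial (Fin n) K)) (k : Fin i) :
    liftDerivation n i D (scaledVar K n k) = 0 := by
  ext N
  rw [coeff_liftDerivation, coeff_scaledVar]
  split_ifs <;> simp

theorem coeff_sum_scaledVar_mul_geomSeries (a : Fin n) (r : ℕ) :
    PowerSeries.coeff r (∑ k : Fin i, scaledVar K n k * geomSeries K a k) =
      if r ≠ 0 then (X a ^ (r - 1)) ⊗ₜ psum (Fin i) K r else 0 := by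
  rw [map_sum]
  cases r with
  | zero => simp [coeff_zero_scaledVar_mul]
  | succ r =>
    rw [if_pos r.succ_ne_zero, psum, tmul_sum, Nat.add_sub_cancel]
    refine Finset.sum_congr rfl fun k _ => ?_
    rw [coeff_succ_scaledVar_mul, geomSeries, PowerSeries.coeff_mk,
      Algebra.TensorProduct.tmul_mul_tmul, one_mul, ← pow_succ']

theorem liftDerivation_pderiv_kernelSeries [CharZero K] {α : K} (hα : α ≠ 0) (a : Fin n) :
    liftDerivation (K := K) n i (α • pderiv a) (kernelSeries α n i) =
      (∑ k, scaledVar K n k * geomSeries K a k) * kernelSeries α n i := by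
  ext N
  rw [coeff_liftDerivation, PowerSeries.coeff_mul, kernelSeries, PowerSeries.coeff_mk]
  simp only [coeff_sum_scaledVar_mul_geomSeries, PowerSeries.coeff_mk, ite_mul, zero_mul]
  rw [← Finset.sum_filter]
  exact pderiv_kernelTerm hα n i N a

/-- The reproducing kernel, with the Dunkl operators that act on the variables `x`. -/
def kernelSystem [CharZero K] {α : K} (hα : α ≠ 0) (n i : ℕ) :
    KernelSystem K (BiSeries K n i) (Fin n) (Fin i) where
  x a := PowerSeries.C (X a ⊗ₜ 1)
  v := scaledVar K n
  geom := geomSeries K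
  kernel := kernelSeries α n i
  der a := liftDerivation n i (α • pderiv a)
  exch := liftExchange i
  divDiff a b := if h : a ≠ b then liftOp n i (dividedDifference a b h) else 0
  sub_mul_divDiff a b h F := by
    rw [dif_pos h, ← map_sub, ← sub_tmul, C_X_sub_X_mul_liftOp_dividedDifference]
  sub_mul_eq_zero a b h F hF := by
    rw [← map_sub, ← sub_tmul] at hF
    exact eq_zero_of_C_X_sub_X_mul_eq_zero h hF
  geom_eq := geomSeries_eq
  exch_geom a b k := by rw [liftExchange_geomSeries, Equiv.swap_apply_right]
  exch_geom_of_ne a b c k hca hcb := by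
    rw [liftExchange_geomSeries, Equiv.swap_apply_of_ne_of_ne hca hcb]
  exch_v := liftExchange_scaledVar
  exch_kernel := liftExchange_kernelSeries α
  der_geom _ _ k h := liftDerivation_pderiv_geomSeries α h k
  der_v _ := liftDerivation_scaledVar _
  der_kernel := liftDerivation_pderiv_kernelSeries hα

variable [CharZero K] {α : K} (hα : α ≠ 0)

theorem liftOp_rationalDunkl (a : Fin n) :
    liftOp n i (rationalDunkl α a) = (kernelSystem hα n i).dunklOp a := by
  rw [rationalDunkl, map_add, map_sum, KernelSystem.dunklOp, ← Finset.filter_ne,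
    Finset.sum_filter]
  congr 1
  refine Finset.sum_congr rfl fun b _ => ?_
  rcases eq_or_ne a b with rfl | h
  · simp
  · simp [kernelSystem, h]

theorem liftOp_shiftedDunkl (s : ℕ) (a : Fin n) :
    liftOp n i (shiftedDunkl α s a) =
      Algebra.lmul K _ ((kernelSystem hα n i).x a) * (kernelSystem hα n i).dunklOp a +
        (s : SeriesEnd K _) := by
  have h : liftOp n i (mulBy (X a)) = Algebra.lmul K _ ((kernelSystem hα n i).x a) :=
    LinearMap.ext fun F => liftOp_mulBy_apply (X a) F
  rw [shiftedDunkl, map_add, map_natCast, dunkl_eq_mulBy_mul_rationalDunkl, map_mul, h,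
    liftOp_rationalDunkl hα]

include hα in
theorem liftOp_dunklProd_kernelSeries {J : Finset (Fin n)} (hJ : J.card = i) :
    liftOp n i (dunklProd α J) (kernelSeries α n i) =
      matchSum (geomSeries K) (J.orderEmbOfFin rfl) * kernelSeries α n i := by
  have h := (kernelSystem hα n i).opProd_mul_dunklOp_kernel (u := 0)
    (J.orderEmbOfFin rfl).toEmbedding (by simp [hJ])
  simp only [zero_add, ← liftOp_shiftedDunkl hα] at h
  rw [dunklProd_eq_opProd, map_opProd]
  exact h

include hα in
theorem liftOp_rationalDunklProd_kernelSeries :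
    liftOp n i (rationalDunklProd α n) (kernelSeries α n i) =
      matchSum (fun a k => scaledVar K n k * geomSeries K a k) id * kernelSeries α n i := by
  rw [rationalDunklProd, map_opProd]
  simp only [liftOp_rationalDunkl hα]
  exact (kernelSystem hα n i).opProd_dunklOp_kernel (Function.Embedding.refl (Fin n))

end KernelSeries

section Swap

variable {K : Type*} [Field K] {n i : ℕ}

/-- The exchange of the two sets of variables. -/
def swapSeries (K : Type*) [Field K] (n i : ℕ) : BiSeries K i n →+* BiSeries K n i :=
  PowerSeries.map (Algebra.TensorProduct.comm K (MvPolynomial (Fin i) K)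
    (MvPolynomial (Fin n) K)).toAlgHom.toRingHom

theorem coeff_swapSeries (N : ℕ) (F : BiSeries K i n) :
    PowerSeries.coeff N (swapSeries K n i F) =
      TensorProduct.comm K (MvPolynomial (Fin i) K) (MvPolynomial (Fin n) K)
        (PowerSeries.coeff N F) :=
  PowerSeries.coeff_map _ _ _

theorem swapSeries_kernelSeries (α : K) :
    swapSeries K n i (kernelSeries α i n) = kernelSeries α n i := by
  ext N
  rw [coeff_swapSeries, kernelSeries, kernelSeries, PowerSeries.coeff_mk, PowerSeries.coeff_mk,
    kernelTerm, kernelTerm, map_sum]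
  refine Finset.sum_congr rfl fun m _ => ?_
  rw [map_smul, TensorProduct.comm_tmul]

theorem swapSeries_geomSeries (a : Fin n) (k : Fin i) :
    swapSeries K n i (geomSeries K k a) = geomSeries K a k := by
  ext N
  rw [coeff_swapSeries, geomSeries, geomSeries, PowerSeries.coeff_mk, PowerSeries.coeff_mk,
    TensorProduct.comm_tmul]

theorem coeff_swapSeries_liftOp (N : ℕ) (L : Module.End K (MvPolynomial (Fin i) K))
    (F : BiSeries K i n) :
    PowerSeries.coeff N (swapSeries K n i (liftOp i n L F)) =
      L.lTensor (MvPolynomial (Fin n) K) (PowerSeries.coeff N (swapSeries K n i F)) := by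
  rw [coeff_swapSeries, coeff_swapSeries, coeff_liftOp]
  exact (LinearMap.lTensor_comm ..).symm

/-- The variable `t x_a`. -/
def scaledVarLeft (K : Type*) [Field K] {n : ℕ} (i : ℕ) (a : Fin n) : BiSeries K n i :=
  PowerSeries.X * PowerSeries.C (X a ⊗ₜ 1)

theorem swapSeries_scaledVar (a : Fin n) :
    swapSeries K n i (scaledVar K i a) = scaledVarLeft K i a := by
  rw [scaledVar, scaledVarLeft, map_mul, swapSeries, PowerSeries.map_X, PowerSeries.map_C]
  rfl

theorem matchSum_scaledVarLeft_mul {k : ℕ} (j : Fin k → Fin n) :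
    matchSum (fun a y => scaledVarLeft K i a * geomSeries K a y) j =
      PowerSeries.X ^ k * (PowerSeries.C ((∏ s, X (j s)) ⊗ₜ 1) * matchSum (geomSeries K) j) := by
  have hprod : ∏ s, scaledVarLeft K i (j s) =
      PowerSeries.X ^ k * PowerSeries.C ((∏ s, X (j s)) ⊗ₜ 1) := by
    simp only [scaledVarLeft, Finset.prod_mul_distrib, Finset.prod_const, Finset.card_univ,
      Fintype.card_fin, ← map_prod]
    congr 2
    exact (map_prod (Algebra.TensorProduct.includeLeft (R := K) (S := K)
      (A := MvPolynomial (Fin n) K) (B := MvPolynomial (Fin i) K)) _ _).symm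
  simp only [matchSum, ← mul_assoc, Finset.mul_sum, Finset.prod_mul_distrib, hprod]

theorem X_pow_mul_liftOp_creation_kernelSeries [CharZero K] {α : K} (hα : α ≠ 0) :
    PowerSeries.X ^ i * liftOp n i (creation α n i) (kernelSeries α n i) =
      matchSum (fun k a => scaledVarLeft K i a * geomSeries K a k) id * kernelSeries α n i := by
  have hmatch := sum_powersetCard_matchSum
    (fun (a : Fin n) (k : Fin i) => scaledVarLeft K i a * geomSeries K a k)
  rw [creation, map_sum, LinearMap.sum_apply, Finset.mul_sum]
  refine Eq.trans ?_ (congrArg (· * kernelSeries α n i) hmatch)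
  rw [Finset.sum_mul]
  refine Finset.sum_congr rfl fun J hJ => ?_
  obtain ⟨-, rfl⟩ := Finset.mem_powersetCard.1 hJ
  have hprod : ∏ a ∈ J, (X a : MvPolynomial (Fin n) K) = ∏ s, X (J.orderEmbOfFin rfl s) := by
    conv_lhs => rw [← Finset.map_orderEmbOfFin_univ J rfl, Finset.prod_map]
    rfl
  rw [matchSum_scaledVarLeft_mul, map_mul, Module.End.mul_apply, liftOp_mulBy_apply,
    liftOp_dunklProd_kernelSeries hα rfl, hprod]
  ring

theorem swapSeries_liftOp_rationalDunklProd_kernelSeries [CharZero K] {α : K} (hα : α ≠ 0) :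
    swapSeries K n i (liftOp i n (rationalDunklProd α i) (kernelSeries α i n)) =
      matchSum (fun k a => scaledVarLeft K i a * geomSeries K a k) id * kernelSeries α n i := by
  rw [liftOp_rationalDunklProd_kernelSeries hα, map_mul, swapSeries_kernelSeries]
  simp only [matchSum, map_sum, map_prod, map_mul, swapSeries_scaledVar, swapSeries_geomSeries]

/-- `B_i^+`, acting on the `n` variables `x` of the kernel, is adjoint to `T_1 ⋯ T_i`, acting on
its `i` variables `y`: both turn the kernel into its product with `∑_τ ∏_k x_{τ k} /
(1 - x_{τ k} y_k)`, the sum over the injections `τ : {1, …, i} → {1, …, n}`. -/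
theorem creation_kernelTerm [CharZero K] {α : K} (hα : α ≠ 0) (n i N : ℕ) :
    (creation α n i).rTensor (MvPolynomial (Fin i) K) (kernelTerm α n i N) =
      (rationalDunklProd α i).lTensor (MvPolynomial (Fin n) K) (kernelTerm α n i (N + i)) := by
  have h := congrArg (PowerSeries.coeff (N + i))
    ((X_pow_mul_liftOp_creation_kernelSeries (n := n) (i := i) hα).trans
      (swapSeries_liftOp_rationalDunklProd_kernelSeries hα).symm)
  rwa [PowerSeries.coeff_X_pow_mul, coeff_swapSeries_liftOp, swapSeries_kernelSeries,
    coeff_liftOp, kernelSeries, PowerSeries.coeff_mk, PowerSeries.coeff_mk] at h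

end Swap

/-! ### The Jack functions as functionals -/

section DualFun

variable {K : Type*} [Field K]

/-- The symmetric function of degree `N` whose scalar product with `g` is the value of `ψ` at the
component of degree `N` of `g(y_1, …, y_i)`. -/
def dualFun (α : K) (i N : ℕ) (ψ : MvPolynomial (Fin i) K →ₗ[K] K) : SymFun K :=
  ∑ m ∈ sizeSet N, ((psumNorm α m)⁻¹ * ψ (psumProd K i m)) • monomial m 1

/-- The contraction of `K[x] ⊗ K[y]` with a functional on `K[y]`. -/
def contract (n : ℕ) {i : ℕ} (ψ : MvPolynomial (Fin i) K →ₗ[K] K) :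
    MvPolynomial (Fin n) K ⊗[K] MvPolynomial (Fin i) K →ₗ[K] MvPolynomial (Fin n) K :=
  (TensorProduct.rid K (MvPolynomial (Fin n) K)).toLinearMap ∘ₗ
    ψ.lTensor (MvPolynomial (Fin n) K)

theorem contract_tmul {n i : ℕ} (ψ : MvPolynomial (Fin i) K →ₗ[K] K)
    (p : MvPolynomial (Fin n) K) (q : MvPolynomial (Fin i) K) :
    contract n ψ (p ⊗ₜ q) = ψ q • p := by
  simp [contract]

theorem contract_rTensor {n i : ℕ} (ψ : MvPolynomial (Fin i) K →ₗ[K] K)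
    (L : Module.End K (MvPolynomial (Fin n) K))
    (p : MvPolynomial (Fin n) K ⊗[K] MvPolynomial (Fin i) K) :
    contract n ψ (L.rTensor _ p) = L (contract n ψ p) := by
  induction p with
  | zero => simp
  | add p q hp hq => simp only [map_add, hp, hq]
  | tmul a b => rw [contract_tmul, LinearMap.rTensor_tmul, contract_tmul, map_smul]

theorem contract_lTensor {n i : ℕ} (ψ : MvPolynomial (Fin i) K →ₗ[K] K)
    (L : Module.End K (MvPolynomial (Fin i) K))
    (p : MvPolynomial (Fin n) K ⊗[K] MvPolynomial (Fin i) K) :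
    contract n ψ (L.lTensor _ p) = contract n (ψ ∘ₗ L) p := by
  rw [contract, contract, LinearMap.lTensor_comp, LinearMap.comp_apply, LinearMap.comp_apply,
    LinearMap.comp_apply]

theorem toVars_dualFun (α : K) (n i N : ℕ) (ψ : MvPolynomial (Fin i) K →ₗ[K] K) :
    toVars n (dualFun α i N ψ) = contract n ψ (kernelTerm α n i N) := by
  rw [dualFun, kernelTerm, map_sum, map_sum]
  refine Finset.sum_congr rfl fun m _ => ?_
  rw [map_smul, map_smul, contract_tmul, smul_smul, psumProd, psumProd]

theorem creation_toVars_dualFun [CharZero K] {α : K} (hα : α ≠ 0) (n i N : ℕ)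
    (ψ : MvPolynomial (Fin i) K →ₗ[K] K) :
    creation α n i (toVars n (dualFun α i N ψ)) =
      toVars n (dualFun α i (N + i) (ψ ∘ₗ rationalDunklProd α i)) := by
  rw [toVars_dualFun, ← contract_rTensor, creation_kernelTerm hα, contract_lTensor, toVars_dualFun]

theorem creation_pow_toVars_dualFun [CharZero K] {α : K} (hα : α ≠ 0) (n i N k : ℕ)
    (ψ : MvPolynomial (Fin i) K →ₗ[K] K) :
    (creation α n i ^ k) (toVars n (dualFun α i N ψ)) =
      toVars n (dualFun α i (N + i * k) (ψ ∘ₗ rationalDunklProd α i ^ k)) := by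
  induction k with
  | zero => rfl
  | succ k ih =>
    rw [pow_succ', Module.End.mul_apply, ih, creation_toVars_dualFun hα, LinearMap.comp_assoc,
      ← Module.End.mul_eq_comp, ← pow_succ, mul_add, mul_one, add_assoc]

/-- The specialization of the last variable to zero. -/
def killLast (K : Type*) [Field K] (i : ℕ) :
    MvPolynomial (Fin (i + 1)) K →ₐ[K] MvPolynomial (Fin i) K :=
  killCompl (Fin.castSucc_injective i)

theorem killCompl_psum {R σ τ : Type*} [CommSemiring R] [Fintype σ] [Fintype τ] {e : σ → τ}
    (he : Function.Injective e) {r : ℕ} (hr : r ≠ 0) :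
    killCompl he (psum τ R r) = psum σ R r := by
  classical
  have hX (b : τ) (hb : b ∉ Set.range e) : killCompl he (X b ^ r : MvPolynomial τ R) = 0 := by
    rw [map_pow, killCompl, aeval_X, dif_neg hb, zero_pow hr]
  rw [psum, psum, map_sum, ← Finset.sum_subset (Finset.subset_univ (Finset.univ.image e))
    fun b _ hb => hX b (by simpa using hb), Finset.sum_image he.injOn]
  refine Finset.sum_congr rfl fun a _ => ?_
  rw [map_pow, ← rename_X (R := R) e a, killCompl_rename_app]

theorem killCompl_toVars {m n : ℕ} {e : Fin m → Fin n} (he : Function.Injective e)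
    (f : SymFun K) : killCompl he (toVars n f) = toVars m f := by
  have h : (killCompl he).comp (toVars (K := K) n) = toVars m := by
    apply algHom_ext
    intro r
    rw [AlgHom.comp_apply, toVars_X, killCompl_psum he r.pos.ne', toVars_X]
  exact DFunLike.congr_fun h f

theorem dualFun_comp_killLast (α : K) (i N : ℕ) (ψ : MvPolynomial (Fin i) K →ₗ[K] K) :
    dualFun α (i + 1) N (ψ ∘ₗ (killLast K i).toLinearMap) = dualFun α i N ψ := by
  refine Finset.sum_congr rfl fun m _ => ?_
  have h : (killLast K i).toLinearMap (psumProd K (i + 1) m) = psumProd K i m :=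
    killCompl_toVars (Fin.castSucc_injective i) _
  rw [LinearMap.comp_apply, h]

/-- The functional `g ↦ ⟨J_λ, g⟩`, where `d k` is the number of columns of length `k` of `λ`,
and `λ` has at most `i` parts. -/
def jackFunctional (α : K) (d : ℕ → ℕ) : (i : ℕ) → MvPolynomial (Fin i) K →ₗ[K] K
  | 0 => lcoeff K 0
  | i + 1 =>
    (jackFunctional α d i ∘ₗ (killLast K i).toLinearMap) ∘ₗ rationalDunklProd α (i + 1) ^ d (i + 1)

/-- The size of the partition with `d k` columns of length `k ≤ i`. -/
def columnSize (d : ℕ → ℕ) (i : ℕ) : ℕ := ∑ k ∈ Finset.range i, (k + 1) * d (k + 1)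

/-- The Jack function of the partition with `d k` columns of length `k ≤ i`. -/
def jackFun (α : K) (d : ℕ → ℕ) (i : ℕ) : SymFun K :=
  dualFun α i (columnSize d i) (jackFunctional α d i)

theorem toVars_jackFun_succ [CharZero K] {α : K} (hα : α ≠ 0) (d : ℕ → ℕ) (n i : ℕ) :
    toVars n (jackFun α d (i + 1)) =
      (creation α n (i + 1) ^ d (i + 1)) (toVars n (jackFun α d i)) := by
  rw [jackFun, jackFun, ← dualFun_comp_killLast α i, creation_pow_toVars_dualFun hα, columnSize,
    Finset.sum_range_succ, jackFunctional, columnSize]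

theorem sizeSet_zero : sizeSet 0 = {0} := by
  have := Finsupp.nonTorsionWeight_of (R := ℕ) (w := fun k : ℕ+ => (k : ℕ)) fun k => k.pos.ne'
  ext m
  rw [mem_sizeSet, Finset.mem_singleton, size, Finsupp.weight_eq_zero_iff_eq_zero]

theorem toVars_jackFun_zero (α : K) (d : ℕ → ℕ) (n : ℕ) :
    toVars n (jackFun α d 0) = 1 := by
  have hpsum : psumProd K 0 0 = 1 := by simp [psumProd]
  have hnorm : psumNorm α 0 = 1 := by simp [psumNorm, zed]
  rw [jackFun, columnSize, Finset.sum_range_zero, dualFun, sizeSet_zero, Finset.sum_singleton,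
    hpsum, hnorm, jackFunctional]
  simp

theorem toVars_jackFun [CharZero K] {α : K} (hα : α ≠ 0) (d : ℕ → ℕ) (n i : ℕ) :
    toVars n (jackFun α d i) =
      (List.ofFn fun k : Fin i => creation α n (i - k) ^ d (i - k)).prod 1 := by
  induction i with
  | zero => simp [toVars_jackFun_zero]
  | succ i ih =>
    rw [toVars_jackFun_succ hα, ih, List.ofFn_succ, List.prod_cons, Module.End.mul_apply]
    simp

end DualFun

section ScalarProduct

variable {K : Type*} [Field K]

theorem scalarProduct_eq_sum (α : K) {f g : SymFun K} {s : Finset (ℕ+ →₀ ℕ)}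
    (hs : ∀ m, coeff m f ≠ 0 → coeff m g ≠ 0 → m ∈ s) :
    scalarProduct α f g = ∑ m ∈ s, coeff m f * coeff m g * psumNorm α m := by
  classical
  calc scalarProduct α f g = ∑ m ∈ f.support ∪ s, coeff m f * coeff m g * psumNorm α m := by
        refine Finset.sum_subset Finset.subset_union_left fun m _ hm => ?_
        rw [notMem_support_iff.1 hm, zero_mul, zero_mul]
    _ = ∑ m ∈ s, coeff m f * coeff m g * psumNorm α m := by
        refine (Finset.sum_subset Finset.subset_union_right fun m _ hm => ?_).symm
        by_contra hne
        have hfg := left_ne_zero_of_mul hne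
        exact hm (hs m (left_ne_zero_of_mul hfg) (right_ne_zero_of_mul hfg))

theorem scalarProduct_comm (α : K) (f g : SymFun K) :
    scalarProduct α f g = scalarProduct α g f := by
  rw [scalarProduct_eq_sum α (f := g) (s := f.support) fun m _ h => mem_support_iff.2 h]
  exact Finset.sum_congr rfl fun m _ => by rw [psumNorm, mul_comm (coeff m f)]

theorem scalarProduct_add_right (α : K) (f g g' : SymFun K) :
    scalarProduct α f (g + g') = scalarProduct α f g + scalarProduct α f g' := by
  simp only [scalarProduct, coeff_add, mul_add, add_mul, Finset.sum_add_distrib]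

theorem scalarProduct_smul_right (α c : K) (f g : SymFun K) :
    scalarProduct α f (c • g) = c • scalarProduct α f g := by
  simp only [scalarProduct, coeff_smul, smul_eq_mul, Finset.mul_sum]
  exact Finset.sum_congr rfl fun m _ => by ring

/-- The scalar product, as a bilinear form. -/
def scalarForm (α : K) : SymFun K →ₗ[K] SymFun K →ₗ[K] K :=
  LinearMap.mk₂ K (scalarProduct α)
    (fun f f' g => by simp only [scalarProduct_comm α _ g, scalarProduct_add_right])
    (fun c f g => by simp only [scalarProduct_comm α _ g, scalarProduct_smul_right])
    (scalarProduct_add_right α) fun c f g => scalarProduct_smul_right α c f g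

theorem coeff_dualFun (α : K) (i N : ℕ) (ψ : MvPolynomial (Fin i) K →ₗ[K] K) (m : ℕ+ →₀ ℕ) :
    coeff m (dualFun α i N ψ) =
      if size m = N then (psumNorm α m)⁻¹ * ψ (psumProd K i m) else 0 := by
  rw [dualFun, coeff_sum]
  simp only [coeff_smul, coeff_monomial, smul_eq_mul, mul_ite, mul_one, mul_zero]
  rw [Finset.sum_ite_eq']
  simp only [mem_sizeSet]

theorem scalarProduct_dualFun [CharZero K] {α : K} (hα : α ≠ 0) (i N : ℕ)
    (ψ : MvPolynomial (Fin i) K →ₗ[K] K) {g : SymFun K}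
    (hg : ∀ m, coeff m g ≠ 0 → size m = N) :
    scalarProduct α (dualFun α i N ψ) g = ψ (toVars i g) := by
  rw [scalarProduct_eq_sum α (s := g.support) fun m _ h => mem_support_iff.2 h]
  conv_rhs => rw [g.as_sum, map_sum, map_sum]
  refine Finset.sum_congr rfl fun m hm => ?_
  have hmon : monomial m (coeff m g) = coeff m g • monomial m (1 : K) := by
    rw [smul_monomial, smul_eq_mul, mul_one]
  have hnorm := psumNorm_ne_zero hα m
  rw [coeff_dualFun, if_pos (hg m (mem_support_iff.1 hm)), hmon, map_smul, map_smul, smul_eq_mul,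
    psumProd]
  field_simp

theorem size_of_coeff_jackFun_ne_zero {α : K} {d : ℕ → ℕ} {i : ℕ} {m : ℕ+ →₀ ℕ}
    (hm : coeff m (jackFun α d i) ≠ 0) : size m = columnSize d i := by
  rw [jackFun, coeff_dualFun] at hm
  exact (ite_ne_right_iff.1 hm).1

theorem scalarProduct_jackFun_of_columnSize_ne (α : K) (d d' : ℕ → ℕ) (i i' : ℕ)
    (h : columnSize d i ≠ columnSize d' i') :
    scalarProduct α (jackFun α d i) (jackFun α d' i') = 0 := by
  rw [scalarProduct_eq_sum α (s := ∅), Finset.sum_empty]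
  exact fun m hm hm' => absurd
    ((size_of_coeff_jackFun_ne_zero hm).symm.trans (size_of_coeff_jackFun_ne_zero hm')) h

end ScalarProduct

section JackDominance

/-- The rows of the partition with `d k` columns of length `k ≤ i`, numbered from `0` and extended
by zeros. -/
def columnParts (d : ℕ → ℕ) (i j : ℕ) : ℕ := ∑ k ∈ Finset.Ico j i, d (k + 1)

theorem columnParts_zero (d : ℕ → ℕ) : columnParts d 0 = 0 := by
  ext j
  simp [columnParts]

theorem support_columnParts_subset (d : ℕ → ℕ) (i : ℕ) :
    (columnParts d i).support ⊆ Finset.range i := by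
  intro j hj
  by_contra hji
  exact hj (by rw [columnParts, Finset.Ico_eq_empty_of_le (by simpa using hji), Finset.sum_empty])

theorem columnParts_succ (d : ℕ → ℕ) (i : ℕ) :
    columnParts d (i + 1) =
      columnParts d i + d (i + 1) • ⇑(indicatorExp (Finset.range (i + 1))) := by
  ext j
  rw [Pi.add_apply, Pi.smul_apply, indicatorExp_apply, columnParts, columnParts]
  rcases Nat.lt_or_ge i j with hij | hij
  · rw [Finset.Ico_eq_empty_of_le hij, Finset.Ico_eq_empty_of_le hij.le,
      if_neg (by simpa using hij)]
    simp
  · rw [Finset.sum_Ico_succ_top hij, if_pos (by simpa [Nat.lt_succ_iff] using hij), smul_eq_mul,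
      mul_one]

theorem support_add_nsmul_indicatorExp_subset {τ : Type*} {b : τ → ℕ} {I : Finset τ}
    (hb : b.support ⊆ I) (k : ℕ) : (b + k • ⇑(indicatorExp I)).support ⊆ I := by
  classical
  intro t ht
  by_contra htI
  have hbt : b t = 0 := by_contra fun hbt => htI (hb hbt)
  refine ht ?_
  rw [Pi.add_apply, Pi.smul_apply, indicatorExp_apply, if_neg (mt Finset.mem_coe.2 htI),
    smul_zero, hbt, add_zero]

theorem Dominated.add_nsmul_indicatorExp {σ τ : Type*} {a : σ → ℕ} {b : τ → ℕ}
    (h : Dominated a b) {J : Finset σ} {I : Finset τ} (hb : b.support ⊆ I)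
    (hJ : J.card ≤ I.card) (k : ℕ) :
    Dominated (a + k • ⇑(indicatorExp J)) (b + k • ⇑(indicatorExp I)) := by
  induction k with
  | zero => simpa using h
  | succ k ih =>
    simp only [succ_nsmul, ← add_assoc]
    exact ih.add_indicatorExp (support_add_nsmul_indicatorExp_subset hb k) hJ

variable {K : Type*} [Field K]

theorem dominated_of_coeff_rationalDunklProd_pow (α : K) {n : ℕ} (k : ℕ)
    {f : MvPolynomial (Fin n) K} {c' : Fin n →₀ ℕ}
    (hc : coeff c' ((rationalDunklProd α n ^ k) f) ≠ 0) :
    ∃ c, coeff c f ≠ 0 ∧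
      Dominated (⇑c' + k • ⇑(indicatorExp (Finset.univ : Finset (Fin n)))) c := by
  induction k generalizing c' with
  | zero => exact ⟨c', hc, by simpa using .refl _⟩
  | succ k ih =>
    rw [pow_succ', Module.End.mul_apply] at hc
    obtain ⟨c₁, hc₁, hdom₁⟩ := dominated_of_coeff_rationalDunklProd α hc
    obtain ⟨c, hcf, hdom⟩ := ih hc₁
    refine ⟨c, hcf, .trans ?_ hdom⟩
    rw [succ_nsmul', ← add_assoc]
    exact hdom₁.add_nsmul_indicatorExp (by simp) le_rfl k

theorem dominated_of_coeff_killLast_monomial {i : ℕ} {a : Fin (i + 1) →₀ ℕ} {c : Fin i →₀ ℕ}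
    (hc : coeff c (killLast K i (monomial a 1)) ≠ 0) : Dominated c a := by
  rw [killLast, coeff_killCompl, coeff_monomial, ite_ne_right_iff] at hc
  have hca : ⇑c = a ∘ Fin.castSucc := by
    rw [hc.1]
    exact funext fun t => (Finsupp.mapDomain_apply (Fin.castSucc_injective i) _ _).symm
  rw [hca]
  exact dominated_comp a (Fin.castSucc_injective i)

theorem dominated_of_jackFunctional (α : K) (d : ℕ → ℕ) (i : ℕ) {a : Fin i →₀ ℕ}
    (ha : jackFunctional α d i (monomial a 1) ≠ 0) : Dominated (columnParts d i) a := by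
  induction i with
  | zero =>
    rw [columnParts_zero]
    exact fun S => ⟨∅, by simp, by simp⟩
  | succ i ih =>
    rw [jackFunctional, LinearMap.comp_apply] at ha
    obtain ⟨b, hb, hψ⟩ := exists_coeff_ne_zero_of_linearMap_ne_zero _ ha
    obtain ⟨a', ha', hdom⟩ := dominated_of_coeff_rationalDunklProd_pow α _ hb
    obtain rfl : a = a' := by
      rw [coeff_monomial, ite_ne_right_iff] at ha'
      exact ha'.1
    rw [LinearMap.comp_apply] at hψ
    obtain ⟨c, hc, hψ⟩ := exists_coeff_ne_zero_of_linearMap_ne_zero _ hψ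
    rw [columnParts_succ]
    exact (((ih hψ).trans (dominated_of_coeff_killLast_monomial hc)).add_nsmul_indicatorExp
      (by simp) (by simp) _).trans hdom

theorem prod_X_eq_monomial {n : ℕ} (J : Finset (Fin n)) :
    (∏ j ∈ J, X j : MvPolynomial (Fin n) K) = monomial (indicatorExp J) 1 :=
  (monomial_sum_one _ _).symm

theorem coeff_creation (α : K) (n i : ℕ) (f : MvPolynomial (Fin n) K) (c : Fin n →₀ ℕ) :
    coeff c (creation α n i f) = ∑ J ∈ Finset.powersetCard i Finset.univ,
      if indicatorExp J ≤ c then coeff (c - indicatorExp J) (dunklProd α J f) else 0 := by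
  rw [creation, LinearMap.sum_apply, coeff_sum]
  refine Finset.sum_congr rfl fun J _ => ?_
  rw [Module.End.mul_apply, mulBy_apply, prod_X_eq_monomial, coeff_monomial_mul', one_mul]

theorem dominated_of_coeff_creation (α : K) {n : ℕ} {τ : Type*} {I : Finset τ} {b : τ → ℕ}
    (hb : b.support ⊆ I) {f : MvPolynomial (Fin n) K} (hf : ∀ c, coeff c f ≠ 0 → Dominated c b)
    {c : Fin n →₀ ℕ} (hc : coeff c (creation α n I.card f) ≠ 0) :
    Dominated c (b + ⇑(indicatorExp I)) := by
  rw [coeff_creation] at hc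
  obtain ⟨J, hJ, hne⟩ := Finset.exists_ne_zero_of_sum_ne_zero hc
  obtain ⟨hle, hne⟩ := ite_ne_right_iff.1 hne
  rw [dunklProd_eq_opProd] at hne
  obtain ⟨c', hc', hdom⟩ := dominated_of_coeff_opProd_shiftedDunkl α _ (fun s => s + 1) hne
  have hdom := (hdom.trans (hf c' hc')).add_indicatorExp hb (Finset.mem_powersetCard.1 hJ).2.le
  rwa [← Finsupp.coe_add, tsub_add_cancel_of_le hle] at hdom

theorem dominated_of_coeff_creation_pow (α : K) {n : ℕ} {τ : Type*} {I : Finset τ} {b : τ → ℕ}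
    (hb : b.support ⊆ I) {f : MvPolynomial (Fin n) K} (hf : ∀ c, coeff c f ≠ 0 → Dominated c b)
    (k : ℕ) {c : Fin n →₀ ℕ} (hc : coeff c ((creation α n I.card ^ k) f) ≠ 0) :
    Dominated c (b + k • ⇑(indicatorExp I)) := by
  induction k generalizing c with
  | zero => simpa using hf c hc
  | succ k ih =>
    rw [pow_succ', Module.End.mul_apply] at hc
    rw [succ_nsmul, ← add_assoc]
    exact dominated_of_coeff_creation α (support_add_nsmul_indicatorExp_subset hb k)
      (fun _ => ih) hc

theorem dominated_of_coeff_jackFun [CharZero K] {α : K} (hα : α ≠ 0) (d : ℕ → ℕ) (n i : ℕ)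
    {c : Fin n →₀ ℕ} (hc : coeff c (toVars n (jackFun α d i)) ≠ 0) :
    Dominated c (columnParts d i) := by
  induction i generalizing c with
  | zero =>
    rw [toVars_jackFun_zero, coeff_one, ite_ne_right_iff] at hc
    rw [← hc.1]
    exact fun S => ⟨∅, by simp, by simp⟩
  | succ i ih =>
    rw [toVars_jackFun_succ hα] at hc
    rw [columnParts_succ]
    have hsupp : (columnParts d i).support ⊆ Finset.range (i + 1) :=
      (support_columnParts_subset d i).trans (mod_cast Finset.range_mono i.le_succ)
    exact dominated_of_coeff_creation_pow α hsupp (fun _ => ih) _ (by rwa [Finset.card_range])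

theorem dominated_of_scalarProduct_jackFun [CharZero K] {α : K} (hα : α ≠ 0) (d d' : ℕ → ℕ)
    (i i' : ℕ) (h : scalarProduct α (jackFun α d i) (jackFun α d' i') ≠ 0) :
    Dominated (columnParts d i) (columnParts d' i') := by
  have hsize : columnSize d i = columnSize d' i' :=
    by_contra fun hne => h (scalarProduct_jackFun_of_columnSize_ne α d d' i i' hne)
  rw [jackFun, scalarProduct_dualFun hα i _ _ fun m hm =>
    (size_of_coeff_jackFun_ne_zero hm).trans hsize.symm] at h
  obtain ⟨a, ha, hψ⟩ := exists_coeff_ne_zero_of_linearMap_ne_zero _ h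
  exact (dominated_of_jackFunctional α d i hψ).trans (dominated_of_coeff_jackFun hα d' i i' ha)

end JackDominance

section Normalization

theorem indicatorExp_le_iff {σ : Type*} {J S : Finset σ} :
    indicatorExp J ≤ indicatorExp S ↔ J ⊆ S := by
  classical
  refine ⟨fun h k hk => ?_, fun h => Finset.sum_le_sum_of_subset h⟩
  by_contra hkS
  simpa [indicatorExp_apply, hk, hkS] using h k

theorem indicatorExp_sub {σ : Type*} [DecidableEq σ] {J S : Finset σ} (h : J ⊆ S) :
    indicatorExp S - indicatorExp J = indicatorExp (S \ J) :=
  tsub_eq_of_eq_add (Finset.sum_sdiff h).symm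

variable {K : Type*} [Field K] {n : ℕ}

theorem coeff_indicatorExp_dunklProd (α : K) {J S : Finset (Fin n)} (h : Disjoint S J)
    (f : MvPolynomial (Fin n) K) :
    coeff (indicatorExp S) (dunklProd α J f) =
      (J.card.factorial : K) * coeff (indicatorExp S) f := by
  rw [dunklProd_eq_opProd, coeff_opProd_shiftedDunkl α _ (fun s => s + 1),
    Finset.prod_range_add_one_eq_factorial]
  intro s
  rw [indicatorExp_apply,
    if_neg (Finset.disjoint_right.1 h (Finset.orderEmbOfFin_mem J rfl s))]

theorem coeff_indicatorExp_creation (α : K) {i N : ℕ} {f : MvPolynomial (Fin n) K}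
    (hf : ∀ S : Finset (Fin n), S.card = N → coeff (indicatorExp S) f = (N.factorial : K))
    (S : Finset (Fin n)) (hS : S.card = N + i) :
    coeff (indicatorExp S) (creation α n i f) = ((N + i).factorial : K) := by
  have hterm (J : Finset (Fin n)) (hJ : J ∈ Finset.powersetCard i S) :
      coeff (indicatorExp S - indicatorExp J) (dunklProd α J f) =
        ((i.factorial * N.factorial : ℕ) : K) := by
    obtain ⟨hJS, rfl⟩ := Finset.mem_powersetCard.1 hJ
    have hcard : (S \ J).card = N := by
      rw [Finset.card_sdiff_of_subset hJS, hS, Nat.add_sub_cancel]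
    rw [indicatorExp_sub hJS, coeff_indicatorExp_dunklProd α Finset.sdiff_disjoint, hf _ hcard,
      Nat.cast_mul]
  have hfilter : (Finset.powersetCard i Finset.univ).filter (· ⊆ S) = Finset.powersetCard i S := by
    ext J
    simp [Finset.mem_powersetCard, and_comm]
  have hchoose := Nat.choose_mul_factorial_mul_factorial (Nat.le_add_left i N)
  rw [Nat.add_sub_cancel] at hchoose
  rw [coeff_creation]
  simp only [indicatorExp_le_iff]
  rw [← Finset.sum_filter, hfilter, Finset.sum_congr rfl hterm, Finset.sum_const,
    Finset.card_powersetCard, hS, nsmul_eq_mul, ← Nat.cast_mul, ← mul_assoc, hchoose]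

theorem coeff_indicatorExp_creation_pow (α : K) {i N : ℕ} {f : MvPolynomial (Fin n) K}
    (hf : ∀ S : Finset (Fin n), S.card = N → coeff (indicatorExp S) f = (N.factorial : K))
    (k : ℕ) (S : Finset (Fin n)) (hS : S.card = N + i * k) :
    coeff (indicatorExp S) ((creation α n i ^ k) f) = ((N + i * k).factorial : K) := by
  induction k generalizing S with
  | zero => exact hf S hS
  | succ k ih =>
    rw [mul_add, mul_one, ← add_assoc] at hS ⊢
    rw [pow_succ']
    exact coeff_indicatorExp_creation α ih S hS

theorem coeff_indicatorExp_jackFun [CharZero K] {α : K} (hα : α ≠ 0) (d : ℕ → ℕ) (i : ℕ)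
    (S : Finset (Fin n)) (hS : S.card = columnSize d i) :
    coeff (indicatorExp S) (toVars n (jackFun α d i)) = ((columnSize d i).factorial : K) := by
  induction i generalizing S with
  | zero =>
    obtain rfl : S = ∅ := by simpa [columnSize] using hS
    rw [toVars_jackFun_zero]
    simp [columnSize, indicatorExp]
  | succ i ih =>
    have hsize : columnSize d (i + 1) = columnSize d i + (i + 1) * d (i + 1) :=
      Finset.sum_range_succ _ _
    rw [hsize] at hS ⊢
    rw [toVars_jackFun_succ hα]
    exact coeff_indicatorExp_creation_pow α ih _ S hS

end Normalization

/-! ### Anisotropy of the scalar product -/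

section Anisotropy

variable {F : Type*} [Field F] [LinearOrder F] [IsStrictOrderedRing F]

theorem eq_zero_of_sum_C_mul_sq_mul_X_pow_eq_zero {ι : Type*} {s : Finset ι} {c : ι → F}
    (hc : ∀ m ∈ s, 0 < c m) (e : ι → ℕ) {P : ι → Polynomial F}
    (h : ∑ m ∈ s, Polynomial.C (c m) * P m ^ 2 * Polynomial.X ^ e m = 0) {m : ι} (hm : m ∈ s) :
    P m = 0 := by
  refine Polynomial.eq_zero_of_infinite_isRoot _ ((Set.Ioi_infinite 0).mono fun t ht => ?_)
  have ht : 0 < t := ht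
  have heval := congrArg (Polynomial.eval t) h
  simp only [Polynomial.eval_finsetSum, Polynomial.eval_mul, Polynomial.eval_C,
    Polynomial.eval_pow, Polynomial.eval_X, Polynomial.eval_zero] at heval
  have hterm := (Finset.sum_eq_zero_iff_of_nonneg fun k hk =>
    mul_nonneg (mul_nonneg (hc k hk).le (sq_nonneg _)) (pow_nonneg ht.le _)).1 heval m hm
  simpa [(hc m hm).ne', ht.ne'] using hterm

theorem eq_zero_of_scalarProduct_X_self {f : SymFun (RatFunc F)}
    (h : scalarProduct RatFunc.X f f = 0) : f = 0 := by
  obtain ⟨b, hb⟩ := IsLocalization.exist_integer_multiples (nonZeroDivisors (Polynomial F))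
    f.support fun m => coeff m f
  choose! P hP using hb
  have hb0 : algebraMap (Polynomial F) (RatFunc F) b ≠ 0 :=
    IsFractionRing.to_map_ne_zero_of_mem_nonZeroDivisors b.2
  have hP (m : ℕ+ →₀ ℕ) (hm : m ∈ f.support) :
      algebraMap (Polynomial F) (RatFunc F) (P m) = algebraMap _ _ (b : Polynomial F) * coeff m f :=
    by rw [hP m hm, Algebra.smul_def]
  have hsum : ∑ m ∈ f.support,
      Polynomial.C (zed m : F) * P m ^ 2 * Polynomial.X ^ m.degree = 0 := by
    apply IsFractionRing.injective (Polynomial F) (RatFunc F)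
    rw [map_zero, map_sum, ← mul_zero (algebraMap (Polynomial F) (RatFunc F) b ^ 2), ← h,
      scalarProduct, Finset.mul_sum]
    refine Finset.sum_congr rfl fun m hm => ?_
    rw [map_mul, map_mul, map_pow, map_pow, hP m hm, RatFunc.algebraMap_X, map_natCast,
      map_natCast]
    ring
  ext m
  rw [coeff_zero]
  by_contra hne
  have hm : m ∈ f.support := mem_support_iff.2 hne
  have hPm := hP m hm
  rw [eq_zero_of_sum_C_mul_sq_mul_X_pow_eq_zero
    (fun m _ => mod_cast Nat.pos_of_ne_zero (zed_ne_zero m)) _ hsum hm, map_zero] at hPm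
  exact mul_ne_zero hb0 hne hPm.symm

end Anisotropy

section Restrictions

variable {K : Type*} [Field K]

theorem pderiv_toVars_eq_sum_fin (n N : ℕ) (a : Fin n) {f : SymFun K}
    (hf : ∀ r ∈ f.vars, (r : ℕ) ≤ N) :
    pderiv a (toVars n f) =
      ∑ j : Fin N, X a ^ (j : ℕ) * (j + 1 : K) • toVars n (pderiv (Nat.succPNat j) f) := by
  have hinj : Function.Injective fun j : Fin N => Nat.succPNat j :=
    Nat.succPNat_injective.comp Fin.val_injective
  have hs : f.vars ⊆ Finset.univ.map ⟨_, hinj⟩ := by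
    intro r hr
    exact Finset.mem_map.2 ⟨⟨r.natPred, by have := hf r hr; have := r.natPred_add_one; omega⟩,
      Finset.mem_univ _, r.succPNat_natPred⟩
  rw [pderiv_toVars n a hs, Finset.sum_map]
  refine Finset.sum_congr rfl fun j _ => ?_
  rw [mul_smul_comm]
  simp [Nat.succPNat_coe]

theorem toVars_pderiv_eq_zero_of_le [CharZero K] {f : SymFun K} {N : ℕ} (h : toVars N f = 0)
    (hf : ∀ k ∈ f.vars, (k : ℕ) ≤ N) {r : ℕ+} (hr : (r : ℕ) ≤ N) :
    toVars N (pderiv r f) = 0 := by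
  have hvandermonde := Matrix.eq_zero_of_forall_index_sum_pow_mul_eq_zero
    (f := fun a : Fin N => (X a : MvPolynomial (Fin N) K))
    (v := fun j : Fin N => (j + 1 : K) • toVars N (pderiv (Nat.succPNat j) f)) X_injective
    fun a => by rw [← pderiv_toVars_eq_sum_fin N N a hf, h, map_zero]
  have hr' := congrFun hvandermonde ⟨r.natPred, by have := r.natPred_add_one; omega⟩
  simp only [PNat.succPNat_natPred, Pi.zero_apply] at hr'
  exact (smul_eq_zero.1 hr').resolve_left (Nat.cast_add_one_ne_zero _)

theorem toVars_eq_zero_of_le {f : SymFun K} {n N : ℕ} (hnN : n ≤ N) (h : toVars N f = 0) :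
    toVars n f = 0 := by
  rw [← killCompl_toVars (Fin.castLE_injective hnN), h, map_zero]

theorem toVars_pderiv_eq_zero [CharZero K] {f : SymFun K} (hf : ∀ n, toVars n f = 0) (r : ℕ+)
    (n : ℕ) : toVars n (pderiv r f) = 0 := by
  obtain ⟨N, hN⟩ := ((insert r f.vars).image fun k : ℕ+ => (k : ℕ)).exists_le
  have hN (k : ℕ+) (hk : k ∈ insert r f.vars) : (k : ℕ) ≤ N :=
    hN _ (Finset.mem_image_of_mem _ hk)
  refine toVars_eq_zero_of_le (le_max_left n N) (toVars_pderiv_eq_zero_of_le (hf _)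
    (fun k hk => ?_) ?_)
  · exact (hN k (Finset.mem_insert_of_mem hk)).trans (le_max_right n N)
  · exact (hN r (Finset.mem_insert_self r _)).trans (le_max_right n N)

theorem coeff_zero_eq_zero_of_toVars_zero {f : SymFun K} (hf : toVars 0 f = 0) :
    coeff 0 f = 0 := by
  have h : (toVars 0 : SymFun K →ₐ[K] _) = (Algebra.ofId K _).comp (aeval fun _ => (0 : K)) := by
    apply algHom_ext
    intro r
    simp [toVars_X, psum]
  rw [h, AlgHom.comp_apply, Algebra.ofId_apply] at hf
  have hconst := C_injective (Fin 0) K (hf.trans C_0.symm)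
  simpa [aeval_zero', constantCoeff_eq] using hconst

theorem coeff_eq_zero_of_toVars [CharZero K] {f : SymFun K} (hf : ∀ n, toVars n f = 0)
    (m : ℕ+ →₀ ℕ) : coeff m f = 0 := by
  induction hd : m.degree generalizing m f with
  | zero =>
    rw [(Finsupp.degree_eq_zero_iff m).1 hd]
    exact coeff_zero_eq_zero_of_toVars_zero (hf 0)
  | succ d ih =>
    obtain ⟨r, hr⟩ := Finsupp.ne_iff.1 fun h : m = 0 => by simp [h] at hd
    have hm := Finsupp.sub_add_single_one_cancel hr
    have hdeg : (m - Finsupp.single r 1).degree = d := by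
      rw [← hm, map_add, Finsupp.degree_single] at hd
      exact Nat.succ_injective hd
    have h := ih (toVars_pderiv_eq_zero hf r) _ hdeg
    rw [coeff_pderiv, hm] at h
    exact (mul_eq_zero.1 h).resolve_right (Nat.cast_add_one_ne_zero _)

theorem eq_of_forall_toVars_eq [CharZero K] {f g : SymFun K} (h : ∀ n, toVars n f = toVars n g) :
    f = g := by
  rw [← sub_eq_zero]
  ext m
  exact coeff_eq_zero_of_toVars (fun n => by rw [map_sub, h, sub_self]) m

end Restrictions

/-! ### Orthogonal triangular families -/

section Triangular

variable {K V ι : Type*} [Field K] [AddCommGroup V] [Module K V] [PartialOrder ι]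

/-- A `B`-orthogonal family whose coordinates under `x` are triangular, normalized by the value `c`
of the coordinate `o`: the three properties that characterize the Jack functions of one degree. -/
structure IsTriangular (B : V →ₗ[K] V →ₗ[K] K) (x : V →ₗ[K] ι → K) (o : ι) (c : K)
    (J : ι → V) : Prop where
  orthogonal : B.IsOrthoᵢ J
  le : ∀ i j, x (J i) j ≠ 0 → j ≤ i
  normalized : ∀ i, x (J i) o = c

/-- The vectors whose coordinates under `x` vanish outside `D`. -/
def coordSupported (x : V →ₗ[K] ι → K) (D : Set ι) : Submodule K V where
  carrier := {f | ∀ i ∉ D, x f i = 0}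
  add_mem' hf hg i hi := by rw [map_add, Pi.add_apply, hf i hi, hg i hi, add_zero]
  zero_mem' i _ := by rw [map_zero, Pi.zero_apply]
  smul_mem' a f hf i hi := by rw [map_smul, Pi.smul_apply, hf i hi, smul_zero]

namespace IsTriangular

variable {B : V →ₗ[K] V →ₗ[K] K} {x : V →ₗ[K] ι → K} {o : ι} {c : K} {J R : ι → V}

theorem apply_eq_zero (h : IsTriangular B x o c J) {D : Set ι} {i : ι} (hi : i ∉ D) {f : V}
    (hf : f ∈ Submodule.span K (J '' D)) : B f (J i) = 0 := by
  refine (Submodule.span_le (p := LinearMap.ker (B.flip (J i)))).2 ?_ hf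
  rintro _ ⟨j, hj, rfl⟩
  exact h.orthogonal (ne_of_mem_of_not_mem hj hi)

theorem linearIndependent (h : IsTriangular B x o c J) (hB : ∀ f, B f f = 0 → f = 0)
    (hc : c ≠ 0) : LinearIndependent K J := by
  refine LinearMap.linearIndependent_of_isOrthoᵢ h.orthogonal fun i hi => hc ?_
  rw [← h.normalized i, hB _ hi, map_zero, Pi.zero_apply]

theorem span_image_eq [Finite ι] (h : IsTriangular B x o c J) (hx : Function.Injective x)
    (hB : ∀ f, B f f = 0 → f = 0) (hc : c ≠ 0) {D : Set ι} (hD : IsLowerSet D) :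
    Submodule.span K (J '' D) = coordSupported x D := by
  classical
  have := Fintype.ofFinite ι
  have := FiniteDimensional.of_injective x hx
  refine Submodule.eq_of_le_of_finrank_le (Submodule.span_le.2 ?_) ?_
  · rintro _ ⟨i, hi, rfl⟩ j hj
    by_contra hij
    exact hj (hD (h.le i j hij) hi)
  · have hspan := finrank_span_eq_card ((h.linearIndependent hB hc).comp _
      (Subtype.val_injective (p := (· ∈ D))))
    rw [Set.range_comp, Subtype.range_coe] at hspan
    rw [hspan, ← Module.finrank_fintype_fun_eq_card K]
    refine LinearMap.finrank_le_finrank_of_injective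
      (f := LinearMap.funLeft K K Subtype.val ∘ₗ x ∘ₗ Submodule.subtype _)
      ((injective_iff_map_eq_zero _).2 fun f hf => Subtype.ext (hx ?_))
    ext i
    by_cases hi : i ∈ D
    · simpa using congrFun hf ⟨i, hi⟩
    · simpa using f.2 i hi

theorem unique [Finite ι] (h : IsTriangular B x o c J) (h' : IsTriangular B x o c R)
    (hx : Function.Injective x) (hB : ∀ f, B f f = 0 → f = 0) (hc : c ≠ 0) : J = R := by
  symm
  funext i
  have hmem : R i ∈ Submodule.span K (J '' Set.Iic i) := by
    rw [h.span_image_eq hx hB hc (isLowerSet_Iic i), ← h'.span_image_eq hx hB hc (isLowerSet_Iic i)]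
    exact Submodule.subset_span ⟨i, Set.self_mem_Iic, rfl⟩
  rw [← Set.Iio_insert, Set.image_insert_eq, Submodule.mem_span_insert] at hmem
  obtain ⟨a, z, hz, hRi⟩ := hmem
  have hzJ : B z (J i) = 0 := h.apply_eq_zero Set.self_notMem_Iio hz
  have hzR : B z (R i) = 0 := by
    rw [h.span_image_eq hx hB hc (isLowerSet_Iio i),
      ← h'.span_image_eq hx hB hc (isLowerSet_Iio i)] at hz
    exact h'.apply_eq_zero Set.self_notMem_Iio hz
  have hz0 : z = 0 := hB z (by simpa [hRi, hzJ] using hzR)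
  have hcoord := congrArg (x · o) hRi
  simp only [hz0, add_zero, map_smul, Pi.smul_apply, h.normalized, h'.normalized,
    smul_eq_mul] at hcoord
  rw [hRi, hz0, add_zero, (mul_eq_right₀ hc).1 hcoord.symm, one_smul]

end IsTriangular

end Triangular

/-! ### The rows of a partition -/

section Lists

theorem sum_range_getD (L : List ℕ) (i : ℕ) :
    ∑ j ∈ Finset.range i, L.getD j 0 = (L.take i).sum := by
  induction L generalizing i with
  | nil => simp
  | cons x L ih =>
    cases i with
    | zero => simp
    | succ i =>
      rw [Finset.sum_range_succ', List.take_succ_cons, List.sum_cons, ← ih, add_comm]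
      simp

theorem map_getD_range {L : List ℕ} {N : ℕ} (h : L.length ≤ N) :
    (List.range N).map (L.getD · 0) = L ++ List.replicate (N - L.length) 0 := by
  refine List.ext_getElem (by simp; omega) fun j hj hj' => ?_
  rw [List.getElem_map, List.getElem_range, List.getElem_append]
  split_ifs with hL
  · exact List.getD_eq_getElem _ _ hL
  · rw [List.getElem_replicate, List.getD_eq_default _ _ (not_lt.1 hL)]

theorem antitone_getD {L : List ℕ} (hL : L.Pairwise (· ≥ ·)) : Antitone (L.getD · 0) := by
  intro i j hij
  simp only
  rcases lt_or_ge j L.length with hj | hj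
  · rw [List.getD_eq_getElem _ _ hj, List.getD_eq_getElem _ _ (hij.trans_lt hj)]
    exact hL.rel_get_of_le (a := ⟨i, hij.trans_lt hj⟩) (b := ⟨j, hj⟩) hij
  · rw [List.getD_eq_default _ _ hj]
    exact Nat.zero_le _

theorem getD_filter_ne_zero {L : List ℕ} (hL : L.Pairwise (· ≥ ·)) (j : ℕ) :
    (L.filter (· ≠ 0)).getD j 0 = L.getD j 0 := by
  induction L generalizing j with
  | nil => rfl
  | cons x L ih =>
    rcases eq_or_ne x 0 with rfl | hx
    · have hzero : (0 :: L : List ℕ) = List.replicate (L.length + 1) 0 :=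
        List.eq_replicate_iff.2 ⟨rfl, fun y hy => by
          rcases List.mem_cons.1 hy with rfl | hy
          · rfl
          · exact Nat.le_zero.1 (List.rel_of_pairwise_cons hL hy)⟩
      rw [hzero, List.filter_replicate]
      simp
    · rw [List.filter_cons_of_pos (by simpa using hx)]
      cases j with
      | zero => simp
      | succ j => simpa using ih hL.of_cons j

end Lists

section Rows

variable {N : ℕ}

/-- The rows of a partition in decreasing order, numbered from `0` and continued by zeros. -/
def row (μ : N.Partition) (j : ℕ) : ℕ := (μ.parts.sort (· ≥ ·)).getD j 0

theorem dominatedBy_iff {μ ν : N.Partition} : DominatedBy μ ν ↔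
    ∀ i, ∑ j ∈ Finset.range i, row μ j ≤ ∑ j ∈ Finset.range i, row ν j := by
  simp only [DominatedBy, row, sum_range_getD]

theorem length_sort_parts_le (μ : N.Partition) : (μ.parts.sort (· ≥ ·)).length ≤ N := by
  rw [Multiset.length_sort]
  conv_rhs => rw [← μ.parts_sum]
  simpa using Multiset.card_nsmul_le_sum (s := μ.parts) (a := 1) fun x hx => μ.parts_pos hx

theorem row_eq_zero (μ : N.Partition) {j : ℕ} (hj : N ≤ j) : row μ j = 0 :=
  List.getD_eq_default _ _ ((length_sort_parts_le μ).trans hj)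

theorem row_antitone (μ : N.Partition) : Antitone (row μ) :=
  antitone_getD (Multiset.pairwise_sort μ.parts (· ≥ ·))

theorem sum_row (μ : N.Partition) : ∑ j ∈ Finset.range N, row μ j = N := by
  simp only [row]
  rw [sum_range_getD, List.take_of_length_le (length_sort_parts_le μ), ← Multiset.sum_coe,
    Multiset.sort_eq, μ.parts_sum]

theorem parts_eq_filter_map_row (μ : N.Partition) :
    μ.parts = ((Multiset.range N).map (row μ)).filter (· ≠ 0) := by
  have hrow : (Multiset.range N).map (row μ) =
      μ.parts + Multiset.replicate (N - (μ.parts.sort (· ≥ ·)).length) 0 := by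
    refine (congrArg Multiset.ofList (map_getD_range (length_sort_parts_le μ))).trans ?_
    rw [← Multiset.coe_add, Multiset.sort_eq, Multiset.coe_replicate]
  rw [hrow, Multiset.filter_add, Multiset.filter_eq_self.2 fun x hx => (μ.parts_pos hx).ne',
    Multiset.filter_eq_nil.2 fun x hx => by simpa using Multiset.eq_of_mem_replicate hx, add_zero]

theorem row_injective : Function.Injective (row : N.Partition → ℕ → ℕ) := fun μ ν h =>
  Nat.Partition.ext (by rw [parts_eq_filter_map_row μ, parts_eq_filter_map_row ν, h])

theorem row_eq_getD {L : List ℕ} (hL : L.Pairwise (· ≥ ·)) {μ : N.Partition}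
    (h : μ.parts = (L.filter (· ≠ 0) : List ℕ)) (j : ℕ) : row μ j = L.getD j 0 := by
  rw [row, h, Multiset.coe_sort,
    List.mergeSort_of_pairwise (by simpa using hL.filter _), getD_filter_ne_zero hL]

theorem row_toPartition {n : ℕ} {lam : Fin n → ℕ} (h : Antitone lam) (j : ℕ) :
    row (toPartition lam) j = part lam (j + 1) := by
  have hL : (List.ofFn lam).Pairwise (· ≥ ·) := List.pairwise_ofFn.2 fun i j hij => h hij.le
  have hparts : (toPartition lam).parts = ((List.ofFn lam).filter (· ≠ 0) : List ℕ) :=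
    congrArg (Multiset.filter (· ≠ 0)) (Fin.univ_val_map lam)
  rw [row_eq_getD hL hparts, part]
  split_ifs with hj
  · rw [List.getD_eq_getElem _ _ (by simpa using hj.2), List.getElem_ofFn]
    rfl
  · exact List.getD_eq_default _ _ (by simp; omega)

theorem DominatedBy.antisymm {μ ν : N.Partition} (h : DominatedBy μ ν) (h' : DominatedBy ν μ) :
    μ = ν := by
  rw [dominatedBy_iff] at h h'
  refine row_injective (funext fun j => ?_)
  have hsucc := (h (j + 1)).antisymm (h' (j + 1))
  rw [Finset.sum_range_succ, Finset.sum_range_succ, (h j).antisymm (h' j)] at hsucc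
  exact Nat.add_left_cancel hsucc

/-- The partitions of `N` with the dominance ordering; not an instance, because the ordering of
partitions is a choice. -/
abbrev dominanceOrder (N : ℕ) : PartialOrder N.Partition where
  le := DominatedBy
  le_refl _ _ := le_rfl
  le_trans _ _ _ h h' i := (h i).trans (h' i)
  le_antisymm _ _ := DominatedBy.antisymm

theorem sum_le_sum_range_card {r : ℕ → ℕ} (hr : Antitone r) (S : Finset ℕ) :
    ∑ s ∈ S, r s ≤ ∑ j ∈ Finset.range S.card, r j := by
  induction S using Finset.induction_on_max with
  | empty => simp
  | insert a S hmax ih =>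
    have haS : a ∉ S := fun ha => (hmax a ha).false
    have hcard : S.card ≤ a := by
      simpa using Finset.card_le_card fun s hs => Finset.mem_range.2 (hmax s hs)
    rw [Finset.sum_insert haS, Finset.card_insert_of_notMem haS, Finset.sum_range_succ, add_comm]
    exact add_le_add ih (hr hcard)

theorem dominatedBy_of_dominated {μ ν : N.Partition} (h : Dominated (row μ) (row ν)) :
    DominatedBy μ ν := by
  rw [dominatedBy_iff]
  intro i
  obtain ⟨T, hT, hle⟩ := h (Finset.range i)
  rw [Finset.card_range] at hT
  exact (hle.trans (sum_le_sum_range_card (row_antitone ν) T)).trans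
    (Finset.sum_le_sum_of_subset (Finset.range_subset_range.2 hT))

/-- The exponent of the monomial `x ^ μ` in `N = |μ|` variables. -/
def rowExp (μ : N.Partition) : Fin N →₀ ℕ := Finsupp.equivFunOnFinite.symm fun j => row μ j

theorem dominated_row_rowExp (μ : N.Partition) : Dominated (row μ) (rowExp μ) := by
  refine dominated_comp_of_support_subset (e := Fin.val) Fin.val_injective fun j hj => ?_
  exact ⟨⟨j, lt_of_not_ge fun hNj => hj (row_eq_zero μ hNj)⟩, rfl⟩

end Rows

/-! ### Expansions in symmetric monomials -/

section Shape

variable {σ τ : Type*}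

/-- The multiset of the nonzero exponents, that is, the parts of the partition whose symmetric
monomial contains `x ^ a`. -/
def shape (a : σ →₀ ℕ) : Multiset ℕ := a.support.val.map a

theorem shape_eq_filter [Fintype σ] (a : σ →₀ ℕ) :
    shape a = (Finset.univ.val.map a).filter (· ≠ 0) := by
  classical
  have hsupp : a.support = Finset.univ.filter (a · ≠ 0) := by
    ext s
    simp
  rw [shape, Multiset.filter_map, hsupp, Finset.filter_val]
  rfl

theorem sum_shape (a : σ →₀ ℕ) : (shape a).sum = a.degree := rfl

theorem exists_parts_eq_shape {N : ℕ} {a : σ →₀ ℕ} (h : a.degree = N) :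
    ∃ μ : N.Partition, μ.parts = shape a := by
  refine ⟨⟨shape a, fun {x} hx => ?_, h⟩, rfl⟩
  obtain ⟨s, hs, rfl⟩ := Multiset.mem_map.1 hx
  exact Nat.pos_of_ne_zero (Finsupp.mem_support_iff.1 hs)

theorem shape_mapDomain {e : σ → τ} (he : Function.Injective e) (a : σ →₀ ℕ) :
    shape (a.mapDomain e) = shape a := by
  classical
  rw [shape, Finsupp.mapDomain_support_of_injective he, Finset.image_val_of_injOn he.injOn,
    Multiset.map_map]
  exact Multiset.map_congr rfl fun s _ => Finsupp.mapDomain_apply he a s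

theorem eq_of_filter_ne_zero_eq {s t : Multiset ℕ} (hcard : s.card = t.card)
    (h : s.filter (· ≠ 0) = t.filter (· ≠ 0)) : s = t := by
  have hs := Multiset.filter_add_not (· ≠ 0) s
  have ht := Multiset.filter_add_not (· ≠ 0) t
  simp only [not_not, Multiset.filter_eq'] at hs ht
  have hcount : s.count 0 = t.count 0 := by
    have hs' := congrArg Multiset.card hs
    have ht' := congrArg Multiset.card ht
    rw [Multiset.card_add, Multiset.card_replicate] at hs' ht'
    rw [h] at hs'
    omega
  rw [← hs, ← ht, h, hcount]

theorem exists_equiv_of_map_univ_eq {γ : Type*} [Fintype σ] [Fintype τ] {a : σ → γ} {b : τ → γ}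
    (h : Finset.univ.val.map a = Finset.univ.val.map b) : ∃ e : σ ≃ τ, ∀ s, b (e s) = a s := by
  classical
  have hcard (c : γ) : Fintype.card {s // a s = c} = Fintype.card {t // b t = c} := by
    have hcount := congrArg (Multiset.count c) h
    rw [Multiset.count_map, Multiset.count_map] at hcount
    simpa only [Fintype.card_subtype, Finset.card_def, Finset.filter_val, eq_comm] using hcount
  exact ⟨Equiv.ofFiberEquiv fun c => Fintype.equivOfCardEq (hcard c),
    Equiv.ofFiberEquiv_map _⟩

theorem exists_perm_of_shape_eq [Finite σ] {a b : σ →₀ ℕ} (h : shape a = shape b) :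
    ∃ e : Equiv.Perm σ, b.mapDomain e = a := by
  have := Fintype.ofFinite σ
  rw [shape_eq_filter, shape_eq_filter] at h
  obtain ⟨e, he⟩ := exists_equiv_of_map_univ_eq (eq_of_filter_ne_zero_eq (by simp) h)
  refine ⟨e.symm, Finsupp.ext fun s => ?_⟩
  rw [Finsupp.mapDomain_equiv_apply, Equiv.symm_symm, he]

theorem shape_rowExp {N : ℕ} (μ : N.Partition) : shape (rowExp μ) = μ.parts := by
  rw [shape_eq_filter, parts_eq_filter_map_row, ← Finset.range_val, ← Nat.Iio_eq_range,
    ← Fin.map_valEmbedding_univ, Finset.map_val, Multiset.map_map]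
  rfl

theorem shape_indicatorExp (S : Finset σ) :
    shape (indicatorExp S) = Multiset.replicate S.card 1 := by
  classical
  have hsupp : (indicatorExp S).support = S := by
    ext s
    simp [indicatorExp_apply]
  rw [shape, hsupp, Multiset.eq_replicate]
  refine ⟨by simp, fun x hx => ?_⟩
  obtain ⟨s, hs, rfl⟩ := Multiset.mem_map.1 hx
  exact (indicatorExp_apply S s).trans (if_pos hs)

theorem parts_onesPartition (N : ℕ) : (onesPartition N).parts = Multiset.replicate N 1 := by
  simp only [onesPartition, Nat.Partition.ofSums_parts]
  exact Multiset.filter_eq_self.2 fun x hx => by simp [Multiset.eq_of_mem_replicate hx]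

end Shape

section MonomialExpansion

theorem prod_map_X {σ R : Type*} [CommSemiring R] [DecidableEq σ] (s : Multiset σ) :
    (s.map (X : σ → MvPolynomial σ R)).prod = monomial (Multiset.toFinsupp s) 1 := by
  induction s using Multiset.induction with
  | empty => simp
  | cons x s ih =>
    rw [Multiset.map_cons, Multiset.prod_cons, ih, X, monomial_mul, one_mul,
      ← Multiset.singleton_add, map_add, Multiset.toFinsupp_singleton]

theorem parts_ofSym {σ : Type*} [DecidableEq σ] {N : ℕ} (s : Sym σ N) :
    (Nat.Partition.ofSym s).parts = shape (Multiset.toFinsupp (s : Multiset σ)) := rfl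

theorem coeff_msymm {σ R : Type*} [Fintype σ] [DecidableEq σ] [CommSemiring R] {N : ℕ}
    (μ : N.Partition) (a : σ →₀ ℕ) :
    coeff a (msymm σ R μ) = if shape a = μ.parts then 1 else 0 := by
  rw [msymm, coeff_sum]
  simp only [prod_map_X, coeff_monomial]
  split_ifs with h
  · have hcard : (Finsupp.toMultiset a).card = N := by
      rw [Finsupp.card_toMultiset, ← μ.parts_sum, ← h]
      rfl
    have hμ : Nat.Partition.ofSym (Sym.mk (Finsupp.toMultiset a) hcard) = μ := by
      apply Nat.Partition.ext
      rw [parts_ofSym, ← h]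
      exact congrArg shape (Finsupp.toMultiset_toFinsupp a)
    rw [Fintype.sum_eq_single ⟨_, hμ⟩, if_pos (Finsupp.toMultiset_toFinsupp a)]
    refine fun s hne => if_neg fun hs => hne (Subtype.ext (Subtype.ext ?_))
    exact (Multiset.toFinsupp_toMultiset _).symm.trans (congrArg Finsupp.toMultiset hs)
  · refine Finset.sum_eq_zero fun s _ => if_neg fun hs => h ?_
    rw [← hs]
    exact (parts_ofSym s.1).symm.trans (congrArg _ s.2)

variable {K : Type*} [Field K] {N : ℕ}

/-- The coefficient of the symmetric monomial `m_μ`, read off from the monomial `x ^ μ`. -/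
def monomialCoeff (K : Type*) [Field K] (μ : N.Partition) : SymFun K →ₗ[K] K :=
  lcoeff K (rowExp μ) ∘ₗ (toVars N).toLinearMap

theorem monomialCoeff_apply (μ : N.Partition) (f : SymFun K) :
    monomialCoeff K μ f = coeff (rowExp μ) (toVars N f) := rfl

theorem monomialCoeff_eq_of_toVars_eq {f : SymFun K} {v : N.Partition → K}
    (h : toVars N f = ∑ μ, v μ • msymm (Fin N) K μ) (μ : N.Partition) :
    monomialCoeff K μ f = v μ := by
  simp only [monomialCoeff_apply, h, coeff_sum, coeff_smul, coeff_msymm, shape_rowExp,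
    ← Nat.Partition.ext_iff, smul_eq_mul, mul_ite, mul_one, mul_zero]
  simp

-- Both exponents appear in `m + n` variables, where they differ by a permutation.
theorem coeff_toVars_of_shape_eq (f : SymFun K) {m n : ℕ} {a : Fin m →₀ ℕ} {b : Fin n →₀ ℕ}
    (h : shape a = shape b) : coeff a (toVars m f) = coeff b (toVars n f) := by
  have hm : Function.Injective (Fin.castAdd n : Fin m → Fin (m + n)) := Fin.castAdd_injective m n
  have hn : Function.Injective (Fin.natAdd m : Fin n → Fin (m + n)) := Fin.natAdd_injective n m
  obtain ⟨e, he⟩ := exists_perm_of_shape_eq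
    (((shape_mapDomain hm a).trans h).trans (shape_mapDomain hn b).symm)
  rw [← killCompl_toVars hm f, ← killCompl_toVars hn f, coeff_killCompl, coeff_killCompl, ← he,
    ← coeff_killCompl e.injective, killCompl_toVars]

theorem isHomogeneous_toVars_monomial (n : ℕ) (m : ℕ+ →₀ ℕ) (c : K) :
    (toVars n (monomial m c)).IsHomogeneous (size m) := by
  rw [toVars, aeval_monomial, size, Finsupp.weight_apply, ← zero_add (m.sum _)]
  refine (isHomogeneous_C (Fin n) c).mul (IsHomogeneous.prod _ _ _ fun k _ => ?_)
  simp only [smul_eq_mul, mul_comm (m k)]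
  refine IsHomogeneous.pow (IsHomogeneous.sum _ _ _ fun j _ => ?_) _
  simpa using (isHomogeneous_X K j).pow (k : ℕ)

theorem isHomogeneous_toVars {f : SymFun K} (hf : ∀ m, coeff m f ≠ 0 → size m = N) (n : ℕ) :
    (toVars n f).IsHomogeneous N := by
  rw [f.as_sum, map_sum]
  refine IsHomogeneous.sum _ _ _ fun m hm => ?_
  rw [← hf m (mem_support_iff.1 hm)]
  exact isHomogeneous_toVars_monomial n m _

theorem toVars_eq_sum_monomialCoeff_smul_msymm {f : SymFun K}
    (hf : ∀ m, coeff m f ≠ 0 → size m = N) (n : ℕ) :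
    toVars n f = ∑ μ : N.Partition, monomialCoeff K μ f • msymm (Fin n) K μ := by
  ext a
  simp only [coeff_sum, coeff_smul, coeff_msymm, smul_eq_mul, mul_ite, mul_one, mul_zero]
  by_cases ha : a.degree = N
  · obtain ⟨μ, hμ⟩ := exists_parts_eq_shape ha
    rw [Fintype.sum_eq_single μ fun κ hκ =>
      if_neg fun h => hκ (Nat.Partition.ext (h.symm.trans hμ.symm)), if_pos hμ.symm]
    exact coeff_toVars_of_shape_eq f (hμ.symm.trans (shape_rowExp μ).symm)
  · rw [Finset.sum_eq_zero fun κ _ => if_neg fun h => ha (by rw [← sum_shape, h, κ.parts_sum])]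
    exact (isHomogeneous_toVars hf n).coeff_eq_zero ha

end MonomialExpansion

/-! ### The family of Jack functions -/

section Columns

variable {N : ℕ}

/-- The number of columns of length `k ≥ 1` of the Young diagram of `μ`. -/
def columnCount (μ : N.Partition) (k : ℕ) : ℕ := row μ (k - 1) - row μ k

theorem columnCount_succ_add_row (μ : N.Partition) (k : ℕ) :
    columnCount μ (k + 1) + row μ (k + 1) = row μ k :=
  Nat.sub_add_cancel (row_antitone μ k.le_succ)

theorem columnParts_columnCount (μ : N.Partition) : columnParts (columnCount μ) N = row μ := by
  funext j
  rcases le_total N j with hj | hj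
  · rw [columnParts, Finset.Ico_eq_empty_of_le hj, Finset.sum_empty, row_eq_zero μ hj]
  · have htelescope : ∀ i, j ≤ i →
        (∑ k ∈ Finset.Ico j i, columnCount μ (k + 1)) + row μ i = row μ j := by
      intro i hi
      induction i, hi using Nat.le_induction with
      | base => simp
      | succ i hi ih =>
        rw [Finset.sum_Ico_succ_top hi, add_assoc, columnCount_succ_add_row, ih]
    simpa only [columnParts, row_eq_zero μ le_rfl, add_zero] using htelescope N hj

theorem columnSize_columnCount (μ : N.Partition) : columnSize (columnCount μ) N = N := by
  have habel : ∀ i,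
      columnSize (columnCount μ) i + i * row μ i = ∑ j ∈ Finset.range i, row μ j := by
    intro i
    induction i with
    | zero => simp [columnSize]
    | succ i ih =>
      rw [columnSize] at ih
      rw [Finset.sum_range_succ, ← ih, columnSize, Finset.sum_range_succ,
        ← columnCount_succ_add_row μ i]
      ring
  simpa only [row_eq_zero μ le_rfl, mul_zero, add_zero, sum_row] using habel N

end Columns

variable {K : Type*} [Field K]

section Existence

variable [CharZero K] {α : K} (hα : α ≠ 0)
include hα

theorem toVars_jackFun_eq_of_le {d : ℕ → ℕ} (n : ℕ) {i j : ℕ} (hij : i ≤ j)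
    (hd : ∀ k, i < k → d k = 0) : toVars n (jackFun α d j) = toVars n (jackFun α d i) := by
  induction j, hij using Nat.le_induction with
  | base => rfl
  | succ j hj ih =>
    rw [toVars_jackFun_succ hα, hd _ (Nat.lt_succ_of_le hj), pow_zero, Module.End.one_apply, ih]

theorem toVars_jackFun_toPartition {n : ℕ} {lam : Fin n → ℕ} (h : Antitone lam) :
    toVars n (jackFun α (columnCount (toPartition lam)) (∑ i, lam i)) = rodrigues α lam := by
  have hcount (k : ℕ) (hk : 1 ≤ k) :
      columnCount (toPartition lam) k = part lam k - part lam (k + 1) := by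
    rw [columnCount, row_toPartition h, row_toPartition h, Nat.sub_add_cancel hk]
  have hvars : toVars n (jackFun α (columnCount (toPartition lam)) (∑ i, lam i)) =
      toVars n (jackFun α (columnCount (toPartition lam)) n) := by
    rcases le_total (∑ i, lam i) n with hle | hle
    · refine (toVars_jackFun_eq_of_le hα n hle fun k hk => ?_).symm
      rw [columnCount, row_eq_zero _ (Nat.le_sub_one_of_lt hk), Nat.zero_sub]
    · refine toVars_jackFun_eq_of_le hα n hle fun k hk => ?_
      rw [hcount k (Nat.one_le_of_lt hk), part, dif_neg fun hk' => hk.not_ge hk'.2, Nat.zero_sub]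
  rw [hvars, toVars_jackFun hα, rodrigues]
  congr 3
  funext k
  rw [hcount _ (Nat.sub_pos_of_lt k.2)]

theorem dominatedBy_of_scalarProduct_jackFun_ne_zero {N : ℕ} {μ ν : N.Partition}
    (h : scalarProduct α (jackFun α (columnCount μ) N) (jackFun α (columnCount ν) N) ≠ 0) :
    DominatedBy μ ν := by
  have hdom := dominated_of_scalarProduct_jackFun hα _ _ _ _ h
  rw [columnParts_columnCount, columnParts_columnCount] at hdom
  exact dominatedBy_of_dominated hdom

theorem scalarProduct_jackFun_columnCount {M N : ℕ} (μ : M.Partition) (ν : N.Partition)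
    (hne : (⟨M, μ⟩ : (k : ℕ) × k.Partition) ≠ ⟨N, ν⟩) :
    scalarProduct α (jackFun α (columnCount μ) M) (jackFun α (columnCount ν) N) = 0 := by
  rcases eq_or_ne M N with rfl | hMN
  · by_contra h
    have hμν := dominatedBy_of_scalarProduct_jackFun_ne_zero hα h
    rw [scalarProduct_comm] at h
    exact hne (congrArg _ (hμν.antisymm (dominatedBy_of_scalarProduct_jackFun_ne_zero hα h)))
  · refine scalarProduct_jackFun_of_columnSize_ne _ _ _ _ _ ?_
    rwa [columnSize_columnCount, columnSize_columnCount]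

theorem dominatedBy_of_monomialCoeff_jackFun_ne_zero {N : ℕ} {μ ν : N.Partition}
    (h : monomialCoeff K μ (jackFun α (columnCount ν) N) ≠ 0) : DominatedBy μ ν := by
  have hdom := dominated_of_coeff_jackFun hα _ _ _ h
  rw [columnParts_columnCount] at hdom
  exact dominatedBy_of_dominated ((dominated_row_rowExp μ).trans hdom)

theorem monomialCoeff_onesPartition_jackFun {N : ℕ} (ν : N.Partition) :
    monomialCoeff K (onesPartition N) (jackFun α (columnCount ν) N) = (N.factorial : K) := by
  have hcard : (Finset.univ : Finset (Fin N)).card = columnSize (columnCount ν) N := by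
    rw [columnSize_columnCount, Finset.card_univ, Fintype.card_fin]
  have hshape : shape (rowExp (onesPartition N)) =
      shape (indicatorExp (Finset.univ : Finset (Fin N))) := by
    rw [shape_rowExp, parts_onesPartition, shape_indicatorExp, Finset.card_univ, Fintype.card_fin]
  rw [monomialCoeff_apply, coeff_toVars_of_shape_eq _ hshape,
    coeff_indicatorExp_jackFun hα _ _ _ hcard, columnSize_columnCount]

theorem isJackFamily_jackFun :
    IsJackFamily α fun N (μ : N.Partition) => jackFun α (columnCount μ) N where
  orthogonal _ _ := scalarProduct_jackFun_columnCount hα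
  triangular N ν := by
    refine ⟨fun μ => monomialCoeff K μ (jackFun α (columnCount ν) N), fun μ => ?_, ?_, ?_⟩
    · exact not_imp_comm.1 (dominatedBy_of_monomialCoeff_jackFun_ne_zero hα)
    · exact toVars_eq_sum_monomialCoeff_smul_msymm fun m hm =>
        (size_of_coeff_jackFun_ne_zero hm).trans (columnSize_columnCount ν)
    · exact monomialCoeff_onesPartition_jackFun hα ν

end Existence

section Uniqueness

/-- The symmetric functions of degree `N`, as those that are combinations of the symmetric
monomials `m_μ`, `|μ| = N`, in any number of variables. -/
def monomialSpan (K : Type*) [Field K] (N : ℕ) : Submodule K (SymFun K) where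
  carrier := {f | ∀ n, toVars n f = ∑ μ : N.Partition, monomialCoeff K μ f • msymm (Fin n) K μ}
  add_mem' hf hg n := by
    simp only [map_add, add_smul, Finset.sum_add_distrib, hf n, hg n]
  zero_mem' n := by simp only [map_zero, zero_smul, Finset.sum_const_zero]
  smul_mem' c f hf n := by
    simp only [map_smul, smul_assoc, ← Finset.smul_sum, hf n]

/-- The coordinates of a symmetric function of degree `N` in the basis of symmetric monomials. -/
def monomialCoords (K : Type*) [Field K] (N : ℕ) : monomialSpan K N →ₗ[K] N.Partition → K :=
  LinearMap.pi (monomialCoeff K) ∘ₗ (monomialSpan K N).subtype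

theorem monomialCoords_injective [CharZero K] (N : ℕ) :
    Function.Injective (monomialCoords K N) := by
  intro f g h
  refine Subtype.ext (eq_of_forall_toVars_eq fun n => ?_)
  rw [f.2 n, g.2 n]
  exact Finset.sum_congr rfl fun μ _ => congrArg (· • _) (congrFun h μ)

namespace IsJackFamily

variable {α : K} {Jack Jack' : (N : ℕ) → N.Partition → SymFun K}

theorem mem_monomialSpan (h : IsJackFamily α Jack) {N : ℕ} (ν : N.Partition) :
    Jack N ν ∈ monomialSpan K N := by
  obtain ⟨v, -, hv, -⟩ := h.triangular N ν
  intro n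
  simp only [monomialCoeff_eq_of_toVars_eq (hv N), hv n]

theorem isTriangular (h : IsJackFamily α Jack) (N : ℕ) :
    letI := dominanceOrder N
    IsTriangular ((scalarForm α).domRestrict₁₂ (monomialSpan K N) (monomialSpan K N))
      (monomialCoords K N) (onesPartition N) (N.factorial : K)
      fun ν => ⟨Jack N ν, h.mem_monomialSpan ν⟩ := by
  let := dominanceOrder N
  refine ⟨fun μ ν hne => ?_, fun ν μ hνμ => ?_, fun ν => ?_⟩
  · exact h.orthogonal N N μ ν fun e => hne (by simpa using e)
  · obtain ⟨v, hle, hv, -⟩ := h.triangular N ν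
    by_contra hμν
    exact hνμ ((monomialCoeff_eq_of_toVars_eq (hv N) μ).trans (hle μ hμν))
  · obtain ⟨v, -, hv, hone⟩ := h.triangular N ν
    exact (monomialCoeff_eq_of_toVars_eq (hv N) _).trans hone

theorem unique [CharZero K] (hα : ∀ f : SymFun K, scalarProduct α f f = 0 → f = 0)
    (h : IsJackFamily α Jack) (h' : IsJackFamily α Jack') : Jack = Jack' := by
  funext N ν
  let := dominanceOrder N
  have huniq := (h.isTriangular N).unique (h'.isTriangular N) (monomialCoords_injective N)
    (fun f hf => Subtype.ext (hα f hf)) (Nat.cast_ne_zero.2 N.factorial_ne_zero)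
  exact congrArg Subtype.val (congrFun huniq ν)

end IsJackFamily

theorem ne_zero_of_anisotropic {α : K} (hα : ∀ f : SymFun K, scalarProduct α f f = 0 → f = 0) :
    α ≠ 0 := by
  rintro rfl
  refine X_ne_zero (1 : ℕ+) (hα (X 1 : SymFun K) (Finset.sum_eq_zero fun m hm => ?_))
  rw [support_X, Finset.mem_singleton] at hm
  simp [hm]

end Uniqueness

end JackRodrigues

end

open JackRodrigues in
theorem theorem1_general {K : Type*} [Field K] [CharZero K] {α : K}
    (hα : ∀ f : SymFun K, scalarProduct α f f = 0 → f = 0) :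
    (∃! Jack : (N : ℕ) → N.Partition → SymFun K, IsJackFamily α Jack) ∧
    ∀ Jack : (N : ℕ) → N.Partition → SymFun K, IsJackFamily α Jack →
      ∀ (n : ℕ) (lam : Fin n → ℕ), Antitone lam →
        toVars n (Jack (∑ i, lam i) (toPartition lam)) = rodrigues α lam := by
  have hα0 : α ≠ 0 := ne_zero_of_anisotropic hα
  have hJack := isJackFamily_jackFun hα0
  refine ⟨⟨_, hJack, fun Jack h => h.unique hα hJack⟩, fun Jack h n lam hlam => ?_⟩
  rw [h.unique hα hJack]
  exact toVars_jackFun_toPartition hα0 hlam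

/-- The Jack functions exist and are unique, and in `n` variables they are given by the Rodrigues
formula. -/
theorem theorem1 :
    (∃! Jack : (N : ℕ) → N.Partition → JackRodrigues.SymFun (RatFunc ℚ),
      JackRodrigues.IsJackFamily (RatFunc.X : RatFunc ℚ) Jack) ∧
    ∀ Jack : (N : ℕ) → N.Partition → JackRodrigues.SymFun (RatFunc ℚ),
      JackRodrigues.IsJackFamily (RatFunc.X : RatFunc ℚ) Jack →
      ∀ (n : ℕ) (lam : Fin n → ℕ), Antitone lam →
        JackRodrigues.toVars n (Jack (∑ i, lam i) (JackRodrigues.toPartition lam)) =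
          JackRodrigues.rodrigues (RatFunc.X : RatFunc ℚ) lam :=
  theorem1_general fun _ => JackRodrigues.eq_zero_of_scalarProduct_X_self
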